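/- Let $p$ be a prime number and let $(R,\mathfrak m)$ be a Noetherian local ring of characteristic $p$ that is $F$-finite (the Frobenius map $F:R\to R$, $r\mapsto r^p$, is finite), of Krull dimension $d\ge 2$. Let $\mathfrak a_1,\mathfrak a_2\subset R$ be ideals with $\mathfrak a_1\cap\mathfrak a_2=0$ and $\dim R/\mathfrak a_1=\dim R/\mathfrak a_2=d$, and put $\mathfrak b=\mathfrak a_1+\mathfrak a_2$. Assume $\dim R/\mathfrak b\ge d-1$. For a Noetherian local ring $(S,\mathfrak n)$ of characteristic $p$, let $\rho$ be the natural Frobenius action on the local cohomology module $H^j_{\mathfrak n}(S)$, i.e. the additive endomorphism induced by the Frobenius map of $S$ (on the Čech complex of a finite generating sequence of $\mathfrak n$ it is induced by the Frobenius maps of the localizations of $S$), which satisfies $\rho(s\xi)=s^p\rho(\xi)$. Let $0^\rho=\{\xi\in H^j_{\mathfrak n}(S) : \rho^e(\xi)=0 \text{ for some } e\in\mathbf N\}$, a submodule of $H^j_{\mathfrak n}(S)$. The ring $S$ is called weakly $F$-nilpotent if $0^\rho=H^j_{\mathfrak n}(S)$ for all $0\le j<\dim S$, and generalized weakly $F$-nilpotent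 if $H^j_{\mathfrak n}(S)/0^\rho$ has finite length over $S$ for all $0\le j<\dim S$. (a) If $R/\mathfrak a_1$, $R/\mathfrak a_2$ and $R/\mathfrak b$ are weakly $F$-nilpotent, then so is $R$. (b) If $R$ is equidimensional (that is, $\dim R/\mathfrak p=\dim R$ for every minimal prime $\mathfrak p$ of $R$) and $R/\mathfrak a_1$, $R/\mathfrak a_2$ and $R/\mathfrak b$ are generalized weakly $F$-nilpotent, then so is $R$. -/

import Mathlib

/-! ### Modules with a Frobenius action

Over a ring `R` of prime characteristic `p`, a Frobenius action on an `R`-module `M` is a `p`-linear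
additive endomorphism `ρ` of `M`, i.e. `ρ (r • m) = r ^ p • ρ m`.  This is exactly a semilinear map
`ρ : M →ₛₗ[frobenius R p] M`. -/

section FrobeniusActions

/-- The orbit closure of `0` in `(M, ρ)`: all `m` with `ρ^e m = 0` for some `e`. -/
def zeroOrbitClosure {R : Type*} [CommRing R] {p : ℕ} [Fact p.Prime] [CharP R p]
    {M : Type*} [AddCommGroup M] [Module R M] (ρ : M →ₛₗ[frobenius R p] M) : Submodule R M where
  carrier := {m | ∃ e : ℕ, (⇑ρ)^[e] m = 0}
  zero_mem' := ⟨0, rfl⟩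
  add_mem' := by
    rintro a b ⟨e, he⟩ ⟨f, hf⟩
    refine ⟨e + f, ?_⟩
    have ha : (⇑ρ)^[e + f] a = 0 := by
      rw [add_comm, Function.iterate_add_apply, he, iterate_map_zero]
    have hb : (⇑ρ)^[e + f] b = 0 := by
      rw [Function.iterate_add_apply, hf, iterate_map_zero]
    rw [iterate_map_add, ha, hb, add_zero]
  smul_mem' := by
    rintro c m ⟨e, he⟩
    have key : ∀ (n : ℕ) (c : R) (m : M), ∃ c' : R, (⇑ρ)^[n] (c • m) = c' • (⇑ρ)^[n] m := by
      intro n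
      induction n with
      | zero => exact fun c m => ⟨c, rfl⟩
      | succ n ih =>
        intro c m
        obtain ⟨c', hc'⟩ := ih (frobenius R p c) (ρ m)
        exact ⟨c', by rw [Function.iterate_succ_apply, LinearMap.map_smulₛₗ, hc',
          Function.iterate_succ_apply]⟩
    obtain ⟨c', hc'⟩ := key e c m
    exact ⟨e, by rw [hc', he, smul_zero]⟩

/-- `(M, ρ)` is nilpotent: every element is killed by some power of `ρ`. -/
def IsNilpotentAction {R : Type*} [CommRing R] {p : ℕ} [Fact p.Prime] [CharP R p]
    {M : Type*} [AddCommGroup M] [Module R M] (ρ : M →ₛₗ[frobenius R p] M) : Prop :=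
  zeroOrbitClosure ρ = ⊤

/-- `(M, ρ)` is generalized nilpotent: `M` modulo the orbit closure of `0` has finite length. -/
def IsGeneralizedNilpotentAction {R : Type*} [CommRing R] {p : ℕ} [Fact p.Prime] [CharP R p]
    {M : Type*} [AddCommGroup M] [Module R M] (ρ : M →ₛₗ[frobenius R p] M) : Prop :=
  IsFiniteLength R (M ⧸ zeroOrbitClosure ρ)

/-- The Frobenius action of the ring `R` on itself, `r ↦ r ^ p`. -/
def frobeniusAction (p : ℕ) [Fact p.Prime] (R : Type*) [CommRing R] [CharP R p] :
    R →ₛₗ[frobenius R p] R where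
  toFun := frobenius R p
  map_add' := map_add _
  map_smul' r s := by simp

/-- A Frobenius action `ρ` on `M` induces one on any localization: `m / s ↦ ρ m / s ^ p`. -/
noncomputable def localizedFrobenius {R : Type*} [CommRing R] {p : ℕ} [Fact p.Prime] [CharP R p]
    {M : Type*} [AddCommGroup M] [Module R M] (S : Submonoid R) (ρ : M →ₛₗ[frobenius R p] M) :
    LocalizedModule S M →ₛₗ[frobenius R p] LocalizedModule S M where
  toFun z := z.liftOn (fun q => LocalizedModule.mk (ρ q.1) (q.2 ^ p)) (by
    rintro ⟨m, s⟩ ⟨n, t⟩ ⟨u, hu⟩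
    refine LocalizedModule.mk_eq.mpr ⟨u ^ p, ?_⟩
    have h := congrArg ρ hu
    simp only [Submonoid.smul_def, LinearMap.map_smulₛₗ, frobenius_def] at h
    simpa only [Submonoid.smul_def, SubmonoidClass.coe_pow] using h)
  map_add' a b := by
    induction a using LocalizedModule.induction_on with | _ m s
    induction b using LocalizedModule.induction_on with | _ n t
    simp only [LocalizedModule.mk_add_mk, LocalizedModule.liftOn_mk, map_add,
      Submonoid.smul_def, LinearMap.map_smulₛₗ, frobenius_def, mul_pow, SubmonoidClass.coe_pow]
  map_smul' r a := by
    induction a using LocalizedModule.induction_on with | _ m s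
    simp only [LocalizedModule.smul'_mk, LocalizedModule.liftOn_mk, LinearMap.map_smulₛₗ]

end FrobeniusActions

/-! ### Local cohomology through the Čech complex

For a finite sequence `x = (x_0, …, x_{n-1})` in `R` and an `R`-module `M`, the (extended) Čech complex
has in degree `j` the product of the localizations `M_{x_{s 0} ⋯ x_{s (j-1)}}` over all
`s : Fin j → Fin n`; in particular it is `M` in degree `0`.  If `R` is Noetherian and `x` generates the
ideal `J`, its cohomology is the local cohomology `H^j_J(M)`. -/

section Cech

/-- The restriction map `M_a → M_b` for `a ∣ b`. -/
noncomputable def awayRestriction {R : Type*} [CommRing R] (M : Type*) [AddCommGroup M] [Module R M]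
    {a b : R} (h : a ∣ b) :
    LocalizedModule (Submonoid.powers a) M →ₗ[R] LocalizedModule (Submonoid.powers b) M :=
  LocalizedModule.lift (Submonoid.powers a) (LocalizedModule.mkLinearMap (Submonoid.powers b) M) (by
    rintro ⟨y, hy⟩
    obtain ⟨k, rfl⟩ := (Submonoid.mem_powers_iff _ _).mp hy
    obtain ⟨c, rfl⟩ := h
    have hu := IsLocalizedModule.map_units
      (LocalizedModule.mkLinearMap (Submonoid.powers (a * c)) M)
      ⟨(a * c) ^ k, (Submonoid.mem_powers_iff _ _).mpr ⟨k, rfl⟩⟩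
    simp only [mul_pow, map_mul] at hu
    exact (((Commute.all (a ^ k) (c ^ k)).map (algebraMap R (Module.End R _))).isUnit_mul_iff.mp hu).1)

/-- On elements coming from `M` the restriction map is the identity: `m / 1 ↦ m / 1`. -/
theorem awayRestriction_mk_one {R : Type*} [CommRing R] (M : Type*) [AddCommGroup M] [Module R M]
    {a b : R} (h : a ∣ b) (m : M) :
    awayRestriction M h (LocalizedModule.mk m 1) = LocalizedModule.mk m 1 :=
  LocalizedModule.lift_mk_one _ _ _ _

theorem localizedFrobenius_awayRestriction {R : Type*} [CommRing R] {p : ℕ} [Fact p.Prime]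
    [CharP R p] {M : Type*} [AddCommGroup M] [Module R M] (ρ : M →ₛₗ[frobenius R p] M)
    {a b : R} (h : a ∣ b) (z : LocalizedModule (Submonoid.powers a) M) :
    localizedFrobenius _ ρ (awayRestriction M h z) =
      awayRestriction M h (localizedFrobenius _ ρ z) := by
  induction z using LocalizedModule.induction_on with | _ m s
  have key : ∀ (m : M) (s : Submonoid.powers a),
      (s : R) • awayRestriction M h (LocalizedModule.mk m s) = LocalizedModule.mk m 1 := by
    intro m s
    rw [← map_smul, LocalizedModule.smul'_mk, ← Submonoid.smul_def, LocalizedModule.mk_cancel,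
      awayRestriction_mk_one]
  have hinj : Function.Injective fun y : LocalizedModule (Submonoid.powers b) M =>
      ((s : R) ^ p) • y := by
    obtain ⟨k, hk⟩ := (Submonoid.mem_powers_iff _ _).mp s.2
    obtain ⟨c, rfl⟩ := h
    have hu := IsLocalizedModule.map_units
      (LocalizedModule.mkLinearMap (Submonoid.powers (a * c)) M)
      ⟨((a * c) ^ k) ^ p, pow_mem ((Submonoid.mem_powers_iff _ _).mpr ⟨k, rfl⟩) p⟩
    have hb := ((Module.End.isUnit_iff _).mp hu).injective
    intro y z hyz
    apply hb
    simp only [Module.algebraMap_end_apply, mul_pow, ← hk] at hyz ⊢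
    exact (mul_smul _ _ y).trans (((smul_comm _ _ y).trans ((congrArg (_ • ·) hyz).trans
      (smul_comm _ _ z))).trans (mul_smul _ _ z).symm)
  apply hinj
  have h1 := congrArg (localizedFrobenius _ ρ) (key m s)
  rw [LinearMap.map_smulₛₗ, frobenius_def] at h1
  have h2 := key (ρ m) (s ^ p)
  rw [SubmonoidClass.coe_pow] at h2
  refine h1.trans (Eq.trans ?_ h2.symm)
  simp [localizedFrobenius, LocalizedModule.liftOn_mk]

theorem awayRestriction_comp {R : Type*} [CommRing R] (M : Type*) [AddCommGroup M] [Module R M]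
    {a b c : R} (h : a ∣ b) (h' : b ∣ c) (z : LocalizedModule (Submonoid.powers a) M) :
    awayRestriction M h' (awayRestriction M h z) = awayRestriction M (h.trans h') z := by
  have : awayRestriction M h' ∘ₗ awayRestriction M h = awayRestriction M (h.trans h') := by
    refine (LocalizedModule.lift_unique _ _ _ _ ?_).symm
    ext m
    simp [awayRestriction_mk_one]
  exact LinearMap.congr_fun this z

theorem prod_face_dvd {R : Type*} [CommRing R] {n : ℕ} (x : Fin n → R) {j : ℕ}
    (s : Fin (j + 1) → Fin n) (i : Fin (j + 1)) :
    (∏ k, x (s (i.succAbove k))) ∣ ∏ k, x (s k) :=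
  ⟨x (s i), by rw [Fin.prod_univ_succAbove _ i, mul_comm]⟩

/-- Čech cochains of degree `j`. -/
abbrev CechCochain {R : Type*} [CommRing R] {n : ℕ} (x : Fin n → R)
    (M : Type*) [AddCommGroup M] [Module R M] (j : ℕ) : Type _ :=
  (s : Fin j → Fin n) → LocalizedModule (Submonoid.powers (∏ k, x (s k))) M

/-- The Čech differential `(dφ)(s) = ∑ i, (-1)^i φ(s_0, …, ŝ_i, …, s_j)`, where the summands are
restricted to the localization belonging to `s`. -/
noncomputable def cechDifferential {R : Type*} [CommRing R] {n : ℕ} (x : Fin n → R)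
    (M : Type*) [AddCommGroup M] [Module R M] (j : ℕ) :
    CechCochain x M j →ₗ[R] CechCochain x M (j + 1) :=
  LinearMap.pi fun s => ∑ i : Fin (j + 1), (-1 : R) ^ (i : ℕ) •
    (awayRestriction M (prod_face_dvd x s i) ∘ₗ
      LinearMap.proj (fun k => s (i.succAbove k)))

theorem cechDifferential_apply {R : Type*} [CommRing R] {n : ℕ} (x : Fin n → R)
    (M : Type*) [AddCommGroup M] [Module R M] (j : ℕ) (φ : CechCochain x M j)
    (s : Fin (j + 1) → Fin n) :
    cechDifferential x M j φ s = ∑ i : Fin (j + 1), (-1 : R) ^ (i : ℕ) •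
      awayRestriction M (prod_face_dvd x s i) (φ fun k => s (i.succAbove k)) := by
  simp [cechDifferential]

/-- The Čech complex is a complex: `d ∘ d = 0`. -/
theorem cechDifferential_comp {R : Type*} [CommRing R] {n : ℕ} (x : Fin n → R)
    (M : Type*) [AddCommGroup M] [Module R M] (j : ℕ) (φ : CechCochain x M j) :
    cechDifferential x M (j + 1) (cechDifferential x M j φ) = 0 := by
  funext s
  simp only [cechDifferential_apply, map_sum, map_smul, awayRestriction_comp, Finset.smul_sum,
    smul_smul, ← pow_add, Pi.zero_apply]
  rw [← Finset.sum_product', Finset.univ_product_univ]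
  have swap : ∀ (t t' : Fin j → Fin n) (ht : (∏ k, x (t k)) ∣ ∏ k, x (s k))
      (ht' : (∏ k, x (t' k)) ∣ ∏ k, x (s k)), t = t' →
      awayRestriction M ht (φ t) = awayRestriction M ht' (φ t') := by
    rintro t _ ht ht' rfl
    rfl
  refine Finset.sum_involution (fun q _ => (q.1.succAbove q.2, q.2.predAbove q.1)) ?_ ?_ ?_ ?_
  · rintro ⟨i, k⟩ -
    dsimp only
    rw [Fin.neg_one_pow_succAbove_add_predAbove, neg_smul, swap _ (fun l => s _) _ _
      (funext fun l => congrArg s (Fin.succAbove_succAbove_succAbove_predAbove i k l).symm)]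
    exact add_neg_cancel _
  · rintro ⟨i, k⟩ - - h
    exact Fin.succAbove_ne i k (congrArg Prod.fst h)
  · simp
  · rintro ⟨i, k⟩ -
    simp [Fin.succAbove_succAbove_predAbove, Fin.predAbove_predAbove_succAbove]

/-- Čech coboundaries of degree `j`: the image of the differential from degree `j - 1`. -/
noncomputable def cechBoundaries {R : Type*} [CommRing R] {n : ℕ} (x : Fin n → R)
    (M : Type*) [AddCommGroup M] [Module R M] : (j : ℕ) → Submodule R (CechCochain x M j)
  | 0 => ⊥
  | j + 1 => LinearMap.range (cechDifferential x M j)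

/-- Čech cocycles of degree `j`. -/
noncomputable def cechCocycles {R : Type*} [CommRing R] {n : ℕ} (x : Fin n → R)
    (M : Type*) [AddCommGroup M] [Module R M] (j : ℕ) : Submodule R (CechCochain x M j) :=
  LinearMap.ker (cechDifferential x M j)

/-- The `j`-th Čech cohomology module, i.e. the local cohomology of `M` with support in the ideal
generated by the sequence `x`. -/
abbrev CechCohomology {R : Type*} [CommRing R] {n : ℕ} (x : Fin n → R)
    (M : Type*) [AddCommGroup M] [Module R M] (j : ℕ) : Type _ :=
  cechCocycles x M j ⧸ (cechBoundaries x M j).submoduleOf (cechCocycles x M j)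

/-- The action on Čech cochains induced by a Frobenius action on `M`. -/
noncomputable def cechCochainFrobenius {R : Type*} [CommRing R] {p : ℕ} [Fact p.Prime] [CharP R p]
    {n : ℕ} (x : Fin n → R) {M : Type*} [AddCommGroup M] [Module R M]
    (ρ : M →ₛₗ[frobenius R p] M) (j : ℕ) :
    CechCochain x M j →ₛₗ[frobenius R p] CechCochain x M j where
  toFun φ s := localizedFrobenius _ ρ (φ s)
  map_add' _ _ := funext fun _ => map_add _ _ _
  map_smul' _ _ := funext fun _ => LinearMap.map_smulₛₗ _ _ _

theorem cechDifferential_frobenius {R : Type*} [CommRing R] {p : ℕ} [Fact p.Prime] [CharP R p]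
    {n : ℕ} (x : Fin n → R) {M : Type*} [AddCommGroup M] [Module R M]
    (ρ : M →ₛₗ[frobenius R p] M) (j : ℕ) (φ : CechCochain x M j) :
    cechDifferential x M j (cechCochainFrobenius x ρ j φ) =
      cechCochainFrobenius x ρ (j + 1) (cechDifferential x M j φ) := by
  funext s
  have : (cechCochainFrobenius x ρ (j + 1) (cechDifferential x M j φ)) s =
    localizedFrobenius _ ρ (cechDifferential x M j φ s) := rfl
  rw [this, cechDifferential_apply, cechDifferential_apply, map_sum]
  refine Finset.sum_congr rfl fun i _ => ?_
  rw [LinearMap.map_smulₛₗ, localizedFrobenius_awayRestriction, map_pow, map_neg, map_one]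
  rfl

/-- The Frobenius action on the Čech cocycles. -/
noncomputable def cechCocycleFrobenius {R : Type*} [CommRing R] {p : ℕ} [Fact p.Prime] [CharP R p]
    {n : ℕ} (x : Fin n → R) {M : Type*} [AddCommGroup M] [Module R M]
    (ρ : M →ₛₗ[frobenius R p] M) (j : ℕ) :
    cechCocycles x M j →ₛₗ[frobenius R p] cechCocycles x M j :=
  LinearMap.codRestrict _ ((cechCochainFrobenius x ρ j).comp (cechCocycles x M j).subtype) (by
    rintro ⟨φ, hφ⟩
    have h : cechDifferential x M j φ = 0 := hφ
    change cechDifferential x M j (cechCochainFrobenius x ρ j φ) = 0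
    rw [cechDifferential_frobenius, h, map_zero])

/-- The natural Frobenius action on the `j`-th Čech cohomology, i.e. on local cohomology, induced by
a Frobenius action `ρ` on `M`. -/
noncomputable def cechCohomologyFrobenius {R : Type*} [CommRing R] {p : ℕ} [Fact p.Prime]
    [CharP R p] {n : ℕ} (x : Fin n → R) {M : Type*} [AddCommGroup M] [Module R M]
    (ρ : M →ₛₗ[frobenius R p] M) (j : ℕ) :
    CechCohomology x M j →ₛₗ[frobenius R p] CechCohomology x M j :=
  Submodule.mapQ _ _ (cechCocycleFrobenius x ρ j) (by
    rintro ⟨φ, hφ⟩ h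
    change φ ∈ cechBoundaries x M j at h
    change cechCochainFrobenius x ρ j φ ∈ cechBoundaries x M j
    cases j with
    | zero =>
      have h0 : φ = 0 := h
      rw [h0, map_zero]
      exact zero_mem _
    | succ j =>
      obtain ⟨ψ, rfl⟩ := h
      exact ⟨cechCochainFrobenius x ρ j ψ, cechDifferential_frobenius x ρ j ψ⟩)

end Cech

/-! ### Nilpotent singularity types -/

section NilpotentSingularities

/-- A (Noetherian) local ring `R` of prime characteristic `p` with maximal ideal `𝔪` is weakly
`F`-nilpotent if its natural Frobenius action on `H^j_𝔪(R)` is nilpotent for all `j < dim R`.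
Here `H^j_𝔪(R)` is computed by the Čech complex of a finite sequence `x` generating `𝔪`; up to an
isomorphism commuting with Frobenius it does not depend on `x`, so `x` ranges over all of them. -/
structure IsWeaklyFNilpotent (p : ℕ) [Fact p.Prime] (R : Type*) [CommRing R] : Prop where
  isLocalRing : IsLocalRing R
  charP : CharP R p
  nilpotent : ∀ (n : ℕ) (x : Fin n → R),
    Ideal.span (Set.range x) = IsLocalRing.maximalIdeal R →
    ∀ j : ℕ, (j : WithBot ℕ∞) < ringKrullDim R →
      IsNilpotentAction (cechCohomologyFrobenius x (frobeniusAction p R) j)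

/-- A (Noetherian) local ring `R` of prime characteristic `p` with maximal ideal `𝔪` is generalized
weakly `F`-nilpotent if its natural Frobenius action on `H^j_𝔪(R)` is generalized nilpotent for all
`j < dim R`. -/
structure IsGeneralizedWeaklyFNilpotent (p : ℕ) [Fact p.Prime] (R : Type*) [CommRing R] :
    Prop where
  isLocalRing : IsLocalRing R
  charP : CharP R p
  generalizedNilpotent : ∀ (n : ℕ) (x : Fin n → R),
    Ideal.span (Set.range x) = IsLocalRing.maximalIdeal R →
    ∀ j : ℕ, (j : WithBot ℕ∞) < ringKrullDim R →
      IsGeneralizedNilpotentAction (cechCohomologyFrobenius x (frobeniusAction p R) j)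

/-- `R` is equidimensional: `dim R/P = dim R` for every minimal prime `P` of `R`. -/
def IsEquidimensionalRing (R : Type*) [CommRing R] : Prop :=
  ∀ P ∈ minimalPrimes R, ringKrullDim (R ⧸ P) = ringKrullDim R

end NilpotentSingularities

/-! Write b = a₁ + a₂. Since a₁ ∩ a₂ = 0, the ideal a₁ embeds in R/a₂ with image b/a₂. This gives
two short exact sequences, 0 → a₁ → R/a₂ → R/b → 0 and 0 → a₁ → R → R/a₁ → 0, whose maps commute
with Frobenius. Their long exact sequences contain the equivariant pieces H^{j-1}(R/b) → H^j(a₁) →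
H^j(R/a₂) and H^j(a₁) → H^j(R) → H^j(R/a₁), exact in the middle (`exists_cechConnecting`,
`cechCohomologyLinearMap_exact`). For j < d the hypotheses cover H^j(R/a₁), H^j(R/a₂) and, because j
- 1 < d - 1 ≤ dim R/b, also H^{j-1}(R/b). It remains to pass from the two ends of an exact sequence
to its middle, once for a₁ and once for R.

For nilpotency this is a short chase. For the generalized notion let A → M → B be exact. The kernel
of M/0^ρ → B/0^ρ is killed by the maximal ideal: p-linearity turns r into r^(p^k) under ρ^k, and a
high power of r kills the finite length module A/0^ρ. If M is Artinian, this kernel has finite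
length, and hence so does M/0^ρ (`IsGeneralizedNilpotentAction.of_exact`).

So local cohomology must be shown to be Artinian (`isArtinian_cechCohomology`). Noetherian induction
and prime filtrations reduce this to R/P. If x_i ∉ P, the kernel of x_i on H^j(R/P) is a quotient of
H^{j-1}(R/(P + x_i)), or zero for j = 0. As x_i acts locally nilpotently on Čech cohomology,
Melkersson's criterion applies. -/

/-! ### Artinian modules -/

section ArtinianModules

/-- Melkersson's criterion for a principal ideal: a module all of whose elements are killed by a
power of `r`, and whose `r`-torsion is Artinian, is Artinian. -/
theorem isArtinian_of_isArtinian_ker_lsmul {R M : Type*} [CommRing R] [AddCommGroup M] [Module R M]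
    (r : R) (htor : ∀ m : M, ∃ n : ℕ, r ^ n • m = 0)
    (hker : IsArtinian R (LinearMap.ker (LinearMap.lsmul R M r))) : IsArtinian R M := by
  rw [← monotone_stabilizes_iff_artinian]
  intro L
  set K := LinearMap.ker (LinearMap.lsmul R M r) with hK
  have mem_K : ∀ m : M, m ∈ K ↔ r • m = 0 := fun m => by simp [hK]
  -- `T n k` is K ∩ r^k L_n, which decreases in both indices.
  let T : ℕ → ℕ → Submodule R K := fun n k =>
    ((OrderDual.ofDual (L n)).map (LinearMap.lsmul R M (r ^ k))).comap K.subtype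
  have mem_T : ∀ n k (y : K), y ∈ T n k ↔ ∃ z ∈ OrderDual.ofDual (L n), r ^ k • z = (y : M) :=
    fun n k y => by simp [T]
  have L_anti : ∀ {n n'}, n ≤ n' → OrderDual.ofDual (L n') ≤ OrderDual.ofDual (L n) :=
    fun h => L.monotone h
  have T_anti : ∀ {n n' k k'}, n ≤ n' → k ≤ k' → T n' k' ≤ T n k := by
    intro n n' k k' hn hk y hy
    obtain ⟨z, hz, hzy⟩ := (mem_T _ _ _).mp hy
    refine (mem_T _ _ _).mpr ⟨r ^ (k' - k) • z, Submodule.smul_mem _ _ (L_anti hn hz), ?_⟩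
    rw [smul_smul, ← pow_add, Nat.add_sub_cancel' hk, hzy]
  have stab : ∀ k, ∃ n, ∀ m, n ≤ m → T n k = T m k := fun k =>
    (monotone_stabilizes_iff_artinian (R := R) (M := K)).mpr hker
      ⟨fun n => OrderDual.toDual (T n k), fun _ _ h => T_anti h le_rfl⟩
  obtain ⟨k₀, hk₀⟩ := (monotone_stabilizes_iff_artinian (R := R) (M := K)).mpr hker
    ⟨fun n => OrderDual.toDual (T n n), fun _ _ h => T_anti h h⟩
  have hdiag : ∀ m, k₀ ≤ m → T k₀ k₀ = T m m := hk₀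
  choose N hN using stab
  let n₁ := max k₀ ((Finset.range k₀).sup N)
  -- One index n₁ serves all k at once: the diagonal chain handles k ≥ k₀, and only finitely many k
  -- < k₀ remain.
  have hT : ∀ m, n₁ ≤ m → ∀ k, T n₁ k = T m k := by
    intro m hm k
    by_cases hk : k < k₀
    · have h1 : N k ≤ n₁ :=
        (Finset.le_sup (f := N) (Finset.mem_range.mpr hk)).trans (le_max_right _ _)
      rw [← hN k n₁ h1, ← hN k m (h1.trans hm)]
    · have hk' := not_lt.mp hk
      have h1 : k₀ ≤ n₁ := le_max_left _ _
      refine le_antisymm ?_ (T_anti hm le_rfl)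
      calc T n₁ k ≤ T k₀ k₀ := T_anti h1 hk'
        _ = T (max m k) (max m k) := hdiag _ (hk'.trans (le_max_right _ _))
        _ ≤ T m k := T_anti (le_max_left _ _) (le_max_right _ _)
  refine ⟨n₁, fun m hm => ?_⟩
  -- Induction on the torsion exponent: r^t y lies in K ∩ r^t L_{n₁} = K ∩ r^t L_m, so some z in L_m
  -- has r^t y = r^t z, and y - z has smaller exponent.
  have key : ∀ t : ℕ, ∀ y ∈ OrderDual.ofDual (L n₁), r ^ t • y = 0 → y ∈ OrderDual.ofDual (L m) := by
    intro t
    induction t with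
    | zero =>
      intro y _ h
      rw [pow_zero, one_smul] at h
      exact h ▸ zero_mem _
    | succ t ih =>
      intro y hy h
      have hyK : r ^ t • y ∈ K := (mem_K _).mpr (by rw [smul_smul, ← pow_succ', h])
      have h1 : (⟨r ^ t • y, hyK⟩ : K) ∈ T n₁ t := (mem_T _ _ _).mpr ⟨y, hy, rfl⟩
      rw [hT m hm t] at h1
      obtain ⟨z, hz, hzy⟩ := (mem_T _ _ _).mp h1
      have h2 := ih (y - z) (Submodule.sub_mem _ hy (L_anti hm hz))
        (by rw [smul_sub, hzy, sub_self])
      simpa using Submodule.add_mem _ h2 hz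
  refine le_antisymm (L.monotone hm) fun y hy => ?_
  obtain ⟨t, ht⟩ := htor y
  exact key t y hy ht

/-- An Artinian module killed by a maximal ideal is Noetherian. -/
theorem isNoetherian_of_isArtinian_of_maximal_smul_eq_zero {R M : Type*} [CommRing R]
    [AddCommGroup M] [Module R M] [IsArtinian R M] (I : Ideal R) [I.IsMaximal]
    (h : ∀ r ∈ I, ∀ m : M, r • m = 0) : IsNoetherian R M := by
  have hM : Module.IsTorsionBySet R M (I : Set R) := fun m r => h r r.2 m
  let := hM.module
  let := Ideal.Quotient.field I
  -- M is a vector space over R/I, hence semisimple, and for semisimple modules Artinian and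
  -- Noetherian are equivalent.
  have h1 : IsSemisimpleModule (R ⧸ I) M := inferInstance
  have : IsSemisimpleModule R M := hM.isSemisimpleModule_iff.mp h1
  exact ((IsSemisimpleModule.finite_tfae (R := R) (M := M)).out 1 2).mpr ‹_›

/-- In a finite length module over a local ring, each element of the maximal ideal acts
nilpotently. -/
theorem exists_pow_smul_eq_zero_of_isFiniteLength {R M : Type*} [CommRing R] [IsLocalRing R]
    [AddCommGroup M] [Module R M] (h : IsFiniteLength R M) {r : R}
    (hr : r ∈ IsLocalRing.maximalIdeal R) : ∃ n : ℕ, ∀ m : M, r ^ n • m = 0 := by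
  obtain ⟨_, _⟩ := isFiniteLength_iff_isNoetherian_isArtinian.mp h
  obtain ⟨n, hn⟩ := IsArtinian.monotone_stabilizes (R := R) (M := M)
    ⟨fun n => OrderDual.toDual (LinearMap.range (LinearMap.lsmul R M (r ^ n))), fun a b hab => by
      rintro _ ⟨m, rfl⟩
      refine ⟨r ^ (b - a) • m, ?_⟩
      simp only [LinearMap.lsmul_apply, smul_smul, ← pow_add, Nat.add_sub_cancel' hab]⟩
  have h1 : LinearMap.range (LinearMap.lsmul R M (r ^ n)) =
      LinearMap.range (LinearMap.lsmul R M (r ^ (n + 1))) := hn (n + 1) n.le_succ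
  refine ⟨n, fun m => ?_⟩
  -- The stable image r^n M equals r · r^n M, so Nakayama's lemma kills it.
  have h2 : LinearMap.range (LinearMap.lsmul R M (r ^ n)) = ⊥ := by
    refine Submodule.eq_bot_of_le_smul_of_le_jacobson_bot (IsLocalRing.maximalIdeal R) _
      (IsNoetherian.noetherian _) ?_ (IsLocalRing.maximalIdeal_le_jacobson _)
    intro y hy
    rw [h1] at hy
    obtain ⟨m, rfl⟩ := hy
    rw [LinearMap.lsmul_apply, pow_succ', mul_smul]
    exact Submodule.smul_mem_smul hr ⟨m, rfl⟩
  have h3 : r ^ n • m ∈ LinearMap.range (LinearMap.lsmul R M (r ^ n)) := ⟨m, rfl⟩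
  rwa [h2, Submodule.mem_bot] at h3

end ArtinianModules

/-! ### Nilpotency of Frobenius actions in exact sequences -/

section FrobeniusExact

variable {R : Type*} [CommRing R] {p : ℕ} [Fact p.Prime] [CharP R p]

theorem iterate_mem_zeroOrbitClosure {M : Type*} [AddCommGroup M] [Module R M]
    {ρ : M →ₛₗ[frobenius R p] M} {m : M} {e : ℕ} :
    (⇑ρ)^[e] m ∈ zeroOrbitClosure ρ ↔ m ∈ zeroOrbitClosure ρ := by
  constructor
  · rintro ⟨f, hf⟩
    exact ⟨f + e, by rw [Function.iterate_add_apply, hf]⟩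
  · rintro ⟨f, hf⟩
    exact ⟨f, by rw [← Function.iterate_add_apply, add_comm, Function.iterate_add_apply, hf,
      iterate_map_zero]⟩

theorem iterate_frobenius_smul {M : Type*} [AddCommGroup M] [Module R M]
    (ρ : M →ₛₗ[frobenius R p] M) (e : ℕ) (r : R) (m : M) :
    (⇑ρ)^[e] (r • m) = r ^ p ^ e • (⇑ρ)^[e] m := by
  induction e generalizing r m with
  | zero => simp
  | succ e ih =>
    rw [Function.iterate_succ_apply, LinearMap.map_smulₛₗ, ih, frobenius_def, ← pow_mul,
      ← pow_succ', Function.iterate_succ_apply]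

theorem map_mem_zeroOrbitClosure {S : Type*} [CommRing S] [CharP S p] {σ : R →+* S}
    {M N : Type*} [AddCommGroup M] [Module R M]
    [AddCommGroup N] [Module S N] {ρM : M →ₛₗ[frobenius R p] M} {ρN : N →ₛₗ[frobenius S p] N}
    {f : M →ₛₗ[σ] N} (hf : Function.Semiconj f ρM ρN) {m : M} (hm : m ∈ zeroOrbitClosure ρM) :
    f m ∈ zeroOrbitClosure ρN := by
  obtain ⟨e, he⟩ := hm
  exact ⟨e, by rw [← (hf.iterate_right e).eq, he, map_zero]⟩

variable {A M B : Type*} [AddCommGroup A] [Module R A] [AddCommGroup M] [Module R M]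
  [AddCommGroup B] [Module R B] {ρA : A →ₛₗ[frobenius R p] A} {ρM : M →ₛₗ[frobenius R p] M}
  {ρB : B →ₛₗ[frobenius R p] B}

theorem IsNilpotentAction.of_exact {f : A →ₗ[R] M} {g : M →ₗ[R] B} (hfg : Function.Exact f g)
    (hf : Function.Semiconj f ρA ρM) (hg : Function.Semiconj g ρM ρB)
    (hA : IsNilpotentAction ρA) (hB : IsNilpotentAction ρB) : IsNilpotentAction ρM := by
  refine Submodule.eq_top_iff'.mpr fun m => ?_
  obtain ⟨e, he⟩ := Submodule.eq_top_iff'.mp hB (g m)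
  rw [← (hg.iterate_right e).eq] at he
  obtain ⟨a, ha⟩ := (hfg _).mp he
  exact iterate_mem_zeroOrbitClosure.mp
    (ha ▸ map_mem_zeroOrbitClosure hf (Submodule.eq_top_iff'.mp hA a))

/-- Only the kernel of M/0^ρ → B/0^ρ needs work. Being Artinian, it is Noetherian as soon as the
maximal ideal kills it, and p-linearity supplies this. -/
theorem IsGeneralizedNilpotentAction.of_exact [IsLocalRing R] [IsArtinian R M]
    {f : A →ₗ[R] M} {g : M →ₗ[R] B} (hfg : Function.Exact f g)
    (hf : Function.Semiconj f ρA ρM) (hg : Function.Semiconj g ρM ρB)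
    (hA : IsGeneralizedNilpotentAction ρA) (hB : IsGeneralizedNilpotentAction ρB) :
    IsGeneralizedNilpotentAction ρM := by
  refine isFiniteLength_iff_isNoetherian_isArtinian.mpr ⟨?_, inferInstance⟩
  obtain ⟨_, -⟩ := isFiniteLength_iff_isNoetherian_isArtinian.mp hB
  let G : (M ⧸ zeroOrbitClosure ρM) →ₗ[R] (B ⧸ zeroOrbitClosure ρB) :=
    Submodule.mapQ _ _ g fun m hm => map_mem_zeroOrbitClosure hg hm
  have hG : IsNoetherian R (LinearMap.ker G) := by
    refine isNoetherian_of_isArtinian_of_maximal_smul_eq_zero (IsLocalRing.maximalIdeal R) ?_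
    rintro r hr ⟨m, hm⟩
    refine Subtype.ext ?_
    obtain ⟨m, rfl⟩ := Submodule.Quotient.mk_surjective _ m
    change Submodule.Quotient.mk (r • m) = 0
    rw [Submodule.Quotient.mk_eq_zero]
    have hm' : g m ∈ zeroOrbitClosure ρB := (Submodule.Quotient.mk_eq_zero _).mp hm
    obtain ⟨e, he⟩ := hm'
    rw [← (hg.iterate_right e).eq] at he
    obtain ⟨a, ha⟩ := (hfg _).mp he
    obtain ⟨n, hn⟩ := exists_pow_smul_eq_zero_of_isFiniteLength hA hr
    -- Applying ρ another n times after ρ^e m = f a makes the exponent of r at least n: ρ^(e+n)(r m)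
    -- is the image of r^(p^(e+n)) ρ^n a, which is already in the orbit closure of 0 in A.
    have hp : n ≤ p ^ (e + n) := (Nat.lt_pow_self (Fact.out : p.Prime).one_lt).le.trans
      (Nat.pow_le_pow_right (Fact.out : p.Prime).pos (Nat.le_add_left n e))
    have h1 : r ^ p ^ (e + n) • (⇑ρA)^[n] a ∈ zeroOrbitClosure ρA := by
      rw [← Submodule.Quotient.mk_eq_zero, Submodule.Quotient.mk_smul,
        ← Nat.sub_add_cancel hp, pow_add, mul_smul, hn, smul_zero]
    have h2 := map_mem_zeroOrbitClosure hf h1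
    rw [map_smul, (hf.iterate_right n).eq, ha, ← Function.iterate_add_apply, add_comm n e,
      ← iterate_frobenius_smul] at h2
    exact iterate_mem_zeroOrbitClosure.mp h2
  exact isNoetherian_of_range_eq_ker (LinearMap.ker G).subtype G
    (by rw [Submodule.range_subtype])

/-- Nilpotency is invariant under semilinear bijections compatible with the actions. -/
theorem IsNilpotentAction.of_bijective {S : Type*} [CommRing S] [CharP S p] {σ : R →+* S}
    {N : Type*} [AddCommGroup N] [Module S N] {ρN : N →ₛₗ[frobenius S p] N} {f : M →ₛₗ[σ] N}
    (hf : Function.Semiconj f ρM ρN) (hbij : Function.Bijective f) (hN : IsNilpotentAction ρN) :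
    IsNilpotentAction ρM := by
  refine Submodule.eq_top_iff'.mpr fun m => ?_
  obtain ⟨e, he⟩ := Submodule.eq_top_iff'.mp hN (f m)
  rw [← (hf.iterate_right e).eq] at he
  exact ⟨e, hbij.1 (he.trans (map_zero f).symm)⟩

/-- Surjectivity of σ makes the R-submodules and the S-submodules correspond, so chain conditions
transfer across the change of rings. -/
theorem IsGeneralizedNilpotentAction.of_bijective {S : Type*} [CommRing S] [CharP S p]
    {σ : R →+* S} [RingHomSurjective σ] {N : Type*} [AddCommGroup N] [Module S N]
    {ρN : N →ₛₗ[frobenius S p] N} {f : M →ₛₗ[σ] N}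
    (hf : Function.Semiconj f ρM ρN) (hbij : Function.Bijective f)
    (hN : IsGeneralizedNilpotentAction ρN) : IsGeneralizedNilpotentAction ρM := by
  let F : (M ⧸ zeroOrbitClosure ρM) →ₛₗ[σ] (N ⧸ zeroOrbitClosure ρN) :=
    Submodule.mapQ _ _ f fun m hm => map_mem_zeroOrbitClosure hf hm
  have hF : Function.Bijective F := by
    constructor
    · refine (injective_iff_map_eq_zero F).mpr fun m hm => ?_
      obtain ⟨m, rfl⟩ := Submodule.Quotient.mk_surjective _ m
      have hm' : f m ∈ zeroOrbitClosure ρN := (Submodule.Quotient.mk_eq_zero _).mp hm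
      obtain ⟨e, he⟩ := hm'
      rw [← (hf.iterate_right e).eq] at he
      exact (Submodule.Quotient.mk_eq_zero _).mpr ⟨e, hbij.1 (he.trans (map_zero f).symm)⟩
    · intro n
      obtain ⟨n, rfl⟩ := Submodule.Quotient.mk_surjective _ n
      obtain ⟨m, rfl⟩ := hbij.2 n
      exact ⟨Submodule.Quotient.mk m, rfl⟩
  obtain ⟨h1, h2⟩ := isFiniteLength_iff_isNoetherian_isArtinian.mp hN
  exact isFiniteLength_iff_isNoetherian_isArtinian.mpr
    ⟨(F.isNoetherian_iff_of_bijective hF).mpr h1, (F.isArtinian_iff_of_bijective hF).mpr h2⟩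

end FrobeniusExact

/-! ### Functoriality of Čech cohomology along ring homomorphisms -/

section LocalizedMap

variable {R S : Type*} [CommRing R] [CommRing S] {σ : R →+* S}
  {M N : Type*} [AddCommGroup M] [Module R M] [AddCommGroup N] [Module S N]

theorem map_mem_powers {a : R} {b : S} (h : σ a = b) (s : Submonoid.powers a) :
    σ s ∈ Submonoid.powers b := by
  obtain ⟨k, hk⟩ := s.2
  exact ⟨k, by simp only [← hk, map_pow, h]⟩

/-- The map `M_a → N_b`, `m / s ↦ g m / σ s`, induced by a `σ`-semilinear map `g`, if `σ a = b`. -/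
noncomputable def localizedAwayMap (g : M →ₛₗ[σ] N) {a : R} {b : S} (h : σ a = b) :
    LocalizedModule (Submonoid.powers a) M →ₛₗ[σ] LocalizedModule (Submonoid.powers b) N where
  toFun z := z.liftOn (fun q => LocalizedModule.mk (g q.1) ⟨σ q.2, map_mem_powers h q.2⟩) (by
    rintro ⟨m, s⟩ ⟨n, t⟩ ⟨u, hu⟩
    refine LocalizedModule.mk_eq.mpr ⟨⟨σ u, map_mem_powers h u⟩, ?_⟩
    have h := congrArg g hu
    simpa only [Submonoid.smul_def, LinearMap.map_smulₛₗ] using h)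
  map_add' y z := by
    induction y using LocalizedModule.induction_on with | _ m s
    induction z using LocalizedModule.induction_on with | _ n t
    simp only [LocalizedModule.mk_add_mk, LocalizedModule.liftOn_mk, map_add,
      Submonoid.smul_def, LinearMap.map_smulₛₗ]
    congr 1
    exact Subtype.ext (map_mul σ _ _)
  map_smul' r z := by
    induction z using LocalizedModule.induction_on with | _ m s
    simp only [LocalizedModule.smul'_mk, LocalizedModule.liftOn_mk, LinearMap.map_smulₛₗ]

theorem localizedAwayMap_mk (g : M →ₛₗ[σ] N) {a : R} {b : S} (h : σ a = b) (m : M)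
    (s : Submonoid.powers a) : localizedAwayMap g h (LocalizedModule.mk m s) =
      LocalizedModule.mk (g m) ⟨σ s, map_mem_powers h s⟩ :=
  rfl

theorem localizedModule_mk_eq_zero {a : R} {m : M} {s : Submonoid.powers a} :
    LocalizedModule.mk m s = 0 ↔ ∃ k : ℕ, a ^ k • m = 0 := by
  rw [← LocalizedModule.zero_mk (1 : Submonoid.powers a), LocalizedModule.mk_eq]
  constructor
  · rintro ⟨⟨_, k, rfl⟩, hk⟩
    exact ⟨k, by simpa [Submonoid.smul_def] using hk⟩
  · rintro ⟨k, hk⟩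
    exact ⟨⟨_, k, rfl⟩, by simpa [Submonoid.smul_def] using hk⟩

theorem localizedAwayMap_injective {g : M →ₛₗ[σ] N} (hg : Function.Injective g) {a : R} {b : S}
    (h : σ a = b) : Function.Injective (localizedAwayMap g h) := by
  refine (injective_iff_map_eq_zero _).mpr fun z hz => ?_
  induction z using LocalizedModule.induction_on with | _ m s
  rw [localizedAwayMap_mk, localizedModule_mk_eq_zero] at hz
  obtain ⟨k, hk⟩ := hz
  refine localizedModule_mk_eq_zero.mpr ⟨k, hg ?_⟩
  rw [LinearMap.map_smulₛₗ, map_pow, h, hk, map_zero]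

theorem localizedAwayMap_surjective {g : M →ₛₗ[σ] N} (hg : Function.Surjective g) {a : R} {b : S}
    (h : σ a = b) : Function.Surjective (localizedAwayMap g h) := by
  intro z
  induction z using LocalizedModule.induction_on with | _ n t
  obtain ⟨_, k, rfl⟩ := t
  obtain ⟨m, rfl⟩ := hg n
  refine ⟨LocalizedModule.mk m ⟨a ^ k, k, rfl⟩, ?_⟩
  rw [localizedAwayMap_mk]
  congr 1
  exact Subtype.ext (by simp [h])

/-- Multiplication by b^k = c^k a^k is injective on M_b and clears both denominators. -/
theorem awayRestriction_mk {a b c : R} (hb : b = a * c) (h : a ∣ b) (m : M) (k : ℕ) :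
    awayRestriction M h (LocalizedModule.mk m (⟨a ^ k, k, rfl⟩ : Submonoid.powers a)) =
      LocalizedModule.mk (c ^ k • m) (⟨b ^ k, k, rfl⟩ : Submonoid.powers b) := by
  have hu := IsLocalizedModule.map_units
    (LocalizedModule.mkLinearMap (Submonoid.powers b) M)
    (⟨b ^ k, k, rfl⟩ : Submonoid.powers b)
  apply ((Module.End.isUnit_iff _).mp hu).injective
  simp only [Module.algebraMap_end_apply]
  have h1 : b ^ k • awayRestriction M h (LocalizedModule.mk m (⟨a ^ k, k, rfl⟩ : Submonoid.powers a)) =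
      c ^ k • LocalizedModule.mk m 1 := by
    have e : b ^ k = c ^ k * a ^ k := by rw [hb, mul_pow, mul_comm]
    rw [e, mul_smul, ← map_smul, LocalizedModule.smul'_mk,
      ← awayRestriction_mk_one M h]
    congr 2
    exact LocalizedModule.mk_cancel (⟨a ^ k, k, rfl⟩ : Submonoid.powers a) m
  have h2 : b ^ k • LocalizedModule.mk (c ^ k • m) (⟨b ^ k, k, rfl⟩ : Submonoid.powers b) =
      c ^ k • LocalizedModule.mk m 1 := by
    rw [LocalizedModule.smul'_mk, LocalizedModule.smul'_mk]
    exact LocalizedModule.mk_cancel (⟨b ^ k, k, rfl⟩ : Submonoid.powers b) _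
  exact h1.trans h2.symm

theorem localizedAwayMap_awayRestriction (g : M →ₛₗ[σ] N) {a b : R} {a' b' : S} (ha : σ a = a')
    (hb : σ b = b') (h : a ∣ b) (h' : a' ∣ b') (z : LocalizedModule (Submonoid.powers a) M) :
    localizedAwayMap g hb (awayRestriction M h z) =
      awayRestriction N h' (localizedAwayMap g ha z) := by
  induction z using LocalizedModule.induction_on with | _ m s
  obtain ⟨_, k, rfl⟩ := s
  obtain ⟨c, hc⟩ := id h
  subst ha hb
  have h1 : localizedAwayMap g rfl (LocalizedModule.mk m ⟨a ^ k, k, rfl⟩) =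
      LocalizedModule.mk (g m) (⟨σ a ^ k, k, rfl⟩ : Submonoid.powers (σ a)) := by
    rw [localizedAwayMap_mk]
    congr 1
    exact Subtype.ext (map_pow σ _ _)
  have hc' : σ b = σ a * σ c := by rw [hc, map_mul]
  refine Eq.trans ?_ (congrArg _ h1).symm
  refine (congrArg _ (awayRestriction_mk hc h m k)).trans ?_
  rw [awayRestriction_mk hc', localizedAwayMap_mk, LinearMap.map_smulₛₗ, map_pow]
  congr 1
  exact Subtype.ext (map_pow σ _ _)

theorem localizedAwayMap_frobenius {p : ℕ} [Fact p.Prime] [CharP R p] [CharP S p]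
    {ρM : M →ₛₗ[frobenius R p] M} {ρN : N →ₛₗ[frobenius S p] N} {g : M →ₛₗ[σ] N}
    (hg : Function.Semiconj g ρM ρN) {a : R} {b : S} (h : σ a = b)
    (z : LocalizedModule (Submonoid.powers a) M) :
    localizedAwayMap g h (localizedFrobenius _ ρM z) =
      localizedFrobenius _ ρN (localizedAwayMap g h z) := by
  induction z using LocalizedModule.induction_on with | _ m s
  change LocalizedModule.mk (g (ρM m)) _ = LocalizedModule.mk (ρN (g m)) _
  rw [hg.eq]
  congr 1
  exact Subtype.ext (map_pow σ _ _)

theorem localizedAwayMap_exact {M' M'' : Type*} [AddCommGroup M'] [Module R M']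
    [AddCommGroup M''] [Module R M''] {f : M' →ₗ[R] M} {g : M →ₗ[R] M''}
    (hfg : Function.Exact f g) (a : R) :
    Function.Exact (localizedAwayMap (σ := RingHom.id R) (a := a) (b := a) f rfl)
      (localizedAwayMap (σ := RingHom.id R) (a := a) (b := a) g rfl) := by
  intro z
  constructor
  · intro hz
    induction z using LocalizedModule.induction_on with | _ m s
    rw [localizedAwayMap_mk, localizedModule_mk_eq_zero] at hz
    obtain ⟨k, hk⟩ := hz
    rw [← map_smul] at hk
    obtain ⟨m', hm'⟩ := (hfg _).mp hk
    refine ⟨LocalizedModule.mk m' (⟨a ^ k, k, rfl⟩ * s), ?_⟩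
    rw [localizedAwayMap_mk, hm']
    exact LocalizedModule.mk_cancel_common_left (⟨a ^ k, k, rfl⟩ : Submonoid.powers a) s m
  · rintro ⟨z, rfl⟩
    induction z using LocalizedModule.induction_on with | _ m s
    rw [localizedAwayMap_mk, localizedAwayMap_mk, hfg.apply_apply_eq_zero, LocalizedModule.zero_mk]

end LocalizedMap

/-! ### Semilinear maps on Čech cochains, cocycles and cohomology -/

section CechMap

theorem map_prod_comp_eq {R S : Type*} [CommRing R] [CommRing S] {σ : R →+* S} {n : ℕ}
    {x : Fin n → R} {y : Fin n → S} (hxy : ∀ i, σ (x i) = y i) {j : ℕ} (s : Fin j → Fin n) :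
    σ (∏ k, x (s k)) = ∏ k, y (s k) :=
  (map_prod σ _ _).trans (Finset.prod_congr rfl fun k _ => hxy (s k))

variable {R S : Type*} [CommRing R] [CommRing S] {σ : R →+* S} {n : ℕ} {x : Fin n → R}
  {y : Fin n → S} (hxy : ∀ i, σ (x i) = y i)
  {M N : Type*} [AddCommGroup M] [Module R M] [AddCommGroup N] [Module S N] (g : M →ₛₗ[σ] N)

/-- The map on Čech cochains induced by a semilinear map. -/
noncomputable def cechCochainMap (j : ℕ) : CechCochain x M j →ₛₗ[σ] CechCochain y N j where
  toFun φ s := localizedAwayMap g (map_prod_comp_eq hxy s) (φ s)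
  map_add' _ _ := funext fun _ => map_add _ _ _
  map_smul' _ _ := funext fun _ => LinearMap.map_smulₛₗ _ _ _

theorem cechCochainMap_apply (j : ℕ) (φ : CechCochain x M j) (s : Fin j → Fin n) :
    cechCochainMap hxy g j φ s = localizedAwayMap g (map_prod_comp_eq hxy s) (φ s) :=
  rfl

theorem cechDifferential_cechCochainMap (j : ℕ) (φ : CechCochain x M j) :
    cechDifferential y N j (cechCochainMap hxy g j φ) =
      cechCochainMap hxy g (j + 1) (cechDifferential x M j φ) := by
  funext s
  rw [cechCochainMap_apply, cechDifferential_apply, cechDifferential_apply, map_sum]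
  refine Finset.sum_congr rfl fun i _ => ?_
  rw [LinearMap.map_smulₛₗ, map_pow, map_neg, map_one, cechCochainMap_apply]
  congr 1
  exact (localizedAwayMap_awayRestriction g _ _ _ _ _).symm

variable {g} in
theorem cechCochainMap_injective (hg : Function.Injective g) (j : ℕ) :
    Function.Injective (cechCochainMap hxy g j) := fun _ _ h =>
  funext fun s => localizedAwayMap_injective hg (map_prod_comp_eq hxy s) (congrFun h s)

variable {g} in
theorem cechCochainMap_surjective (hg : Function.Surjective g) (j : ℕ) :
    Function.Surjective (cechCochainMap hxy g j) := fun φ => by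
  choose ψ hψ using fun s => localizedAwayMap_surjective hg (map_prod_comp_eq hxy s) (φ s)
  exact ⟨ψ, funext hψ⟩

/-- The map on Čech cocycles induced by a semilinear map. -/
noncomputable def cechCocycleMap (j : ℕ) : cechCocycles x M j →ₛₗ[σ] cechCocycles y N j :=
  LinearMap.codRestrict _ ((cechCochainMap hxy g j).comp (cechCocycles x M j).subtype) (by
    rintro ⟨φ, hφ⟩
    have h : cechDifferential x M j φ = 0 := hφ
    change cechDifferential y N j (cechCochainMap hxy g j φ) = 0
    rw [cechDifferential_cechCochainMap, h, map_zero])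

theorem cechCochainMap_mem_cechBoundaries {j : ℕ} {φ : CechCochain x M j}
    (h : φ ∈ cechBoundaries x M j) : cechCochainMap hxy g j φ ∈ cechBoundaries y N j := by
  cases j with
  | zero =>
    have h0 : φ = 0 := h
    rw [h0, map_zero]
    exact zero_mem _
  | succ j =>
    obtain ⟨ψ, rfl⟩ := h
    exact ⟨cechCochainMap hxy g j ψ, cechDifferential_cechCochainMap hxy g j ψ⟩

/-- The map on Čech cohomology induced by a semilinear map. -/
noncomputable def cechCohomologyMap (j : ℕ) : CechCohomology x M j →ₛₗ[σ] CechCohomology y N j :=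
  Submodule.mapQ _ _ (cechCocycleMap hxy g j)
    fun _ h => cechCochainMap_mem_cechBoundaries hxy g h

theorem cechCochainMap_frobenius {p : ℕ} [Fact p.Prime] [CharP R p] [CharP S p]
    {ρM : M →ₛₗ[frobenius R p] M} {ρN : N →ₛₗ[frobenius S p] N}
    {g : M →ₛₗ[σ] N} (hg : Function.Semiconj g ρM ρN) (j : ℕ) :
    Function.Semiconj (cechCochainMap hxy g j) (cechCochainFrobenius x ρM j)
      (cechCochainFrobenius y ρN j) := fun _ =>
  funext fun s => localizedAwayMap_frobenius hg (map_prod_comp_eq hxy s) _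

theorem cechCohomologyMap_frobenius {p : ℕ} [Fact p.Prime] [CharP R p] [CharP S p]
    {ρM : M →ₛₗ[frobenius R p] M} {ρN : N →ₛₗ[frobenius S p] N}
    {g : M →ₛₗ[σ] N} (hg : Function.Semiconj g ρM ρN) (j : ℕ) :
    Function.Semiconj (cechCohomologyMap hxy g j) (cechCohomologyFrobenius x ρM j)
      (cechCohomologyFrobenius y ρN j) := by
  intro ξ
  obtain ⟨φ, rfl⟩ := Submodule.Quotient.mk_surjective _ ξ
  exact congrArg Submodule.Quotient.mk (Subtype.ext (cechCochainMap_frobenius hxy hg j φ))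

variable {g} in
-- The cochain maps are bijective in every degree and commute with the differentials. Semilinearity
-- lets this compare Čech cohomology over R with that over a quotient ring.
theorem cechCohomologyMap_bijective (hg : Function.Bijective g) (j : ℕ) :
    Function.Bijective (cechCohomologyMap hxy g j) := by
  constructor
  · refine (injective_iff_map_eq_zero _).mpr fun ξ hξ => ?_
    obtain ⟨φ, rfl⟩ := Submodule.Quotient.mk_surjective _ ξ
    have h : cechCocycleMap hxy g j φ ∈ (cechBoundaries y N j).submoduleOf (cechCocycles y N j) :=
      (Submodule.Quotient.mk_eq_zero _).mp hξ
    change cechCochainMap hxy g j φ ∈ cechBoundaries y N j at h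
    refine (Submodule.Quotient.mk_eq_zero _).mpr ?_
    change (φ : CechCochain x M j) ∈ cechBoundaries x M j
    cases j with
    | zero => exact cechCochainMap_injective hxy hg.1 0 (Eq.trans h (map_zero _).symm)
    | succ j =>
      obtain ⟨ψ, hψ⟩ := h
      obtain ⟨ψ, rfl⟩ := cechCochainMap_surjective hxy hg.2 j ψ
      exact ⟨ψ, cechCochainMap_injective hxy hg.1 _
        ((cechDifferential_cechCochainMap hxy g j ψ).symm.trans hψ)⟩
  · intro ξ
    obtain ⟨⟨φ, hφ⟩, rfl⟩ := Submodule.Quotient.mk_surjective _ ξ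
    obtain ⟨ψ, rfl⟩ := cechCochainMap_surjective hxy hg.2 j φ
    refine ⟨Submodule.Quotient.mk ⟨ψ, cechCochainMap_injective hxy hg.1 _ ?_⟩, rfl⟩
    rw [← cechDifferential_cechCochainMap, map_zero]
    exact hφ

end CechMap

/-! ### The long exact sequence of Čech cohomology -/

section LongExact

variable {R : Type*} [CommRing R] {n : ℕ} (x : Fin n → R)
  {M' M M'' : Type*} [AddCommGroup M'] [Module R M'] [AddCommGroup M] [Module R M]
  [AddCommGroup M''] [Module R M'']

/-- The map on Čech cochains induced by a linear map. -/
noncomputable abbrev cechCochainLinearMap (f : M' →ₗ[R] M) (j : ℕ) :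
    CechCochain x M' j →ₗ[R] CechCochain x M j :=
  cechCochainMap (σ := RingHom.id R) (x := x) (y := x) (fun _ => rfl) f j

/-- The map on Čech cohomology induced by a linear map. -/
noncomputable abbrev cechCohomologyLinearMap (f : M' →ₗ[R] M) (j : ℕ) :
    CechCohomology x M' j →ₗ[R] CechCohomology x M j :=
  cechCohomologyMap (σ := RingHom.id R) (x := x) (y := x) (fun _ => rfl) f j

variable {f : M' →ₗ[R] M} {g : M →ₗ[R] M''}

theorem cechCochainLinearMap_exact (hfg : Function.Exact f g) (j : ℕ) :
    Function.Exact (cechCochainLinearMap x f j) (cechCochainLinearMap x g j) := by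
  intro φ
  constructor
  · intro h
    choose ψ hψ using fun s => (localizedAwayMap_exact hfg _ _).mp (congrFun h s)
    exact ⟨ψ, funext hψ⟩
  · rintro ⟨ψ, rfl⟩
    exact funext fun s => (localizedAwayMap_exact hfg _ _).mpr ⟨ψ s, rfl⟩

theorem cechCohomology_mk_eq_zero {j : ℕ} {φ : cechCocycles x M j} :
    (Submodule.Quotient.mk φ : CechCohomology x M j) = 0 ↔
      (φ : CechCochain x M j) ∈ cechBoundaries x M j :=
  Submodule.Quotient.mk_eq_zero _

theorem cechCohomologyLinearMap_mk (f : M' →ₗ[R] M) {j : ℕ} (φ : cechCocycles x M' j) :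
    cechCohomologyLinearMap x f j (Submodule.Quotient.mk φ) =
      Submodule.Quotient.mk (cechCocycleMap (σ := RingHom.id R) (fun _ => rfl) f j φ) :=
  rfl

theorem cechCohomologyLinearMap_mk_eq_zero (f : M' →ₗ[R] M) {j : ℕ} {φ : cechCocycles x M' j} :
    cechCohomologyLinearMap x f j (Submodule.Quotient.mk φ) = 0 ↔
      cechCochainLinearMap x f j φ ∈ cechBoundaries x M j :=
  cechCohomology_mk_eq_zero x

theorem cechDifferential_cechCochainLinearMap (f : M' →ₗ[R] M) (j : ℕ) (φ : CechCochain x M' j) :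
    cechDifferential x M j (cechCochainLinearMap x f j φ) =
      cechCochainLinearMap x f (j + 1) (cechDifferential x M' j φ) :=
  cechDifferential_cechCochainMap _ f j φ

/-- Exactness on cochains gives a preimage; it is a cocycle because f stays injective one degree
higher. -/
theorem exists_cechCocycle_of_mem_ker (hf : Function.Injective f) (hfg : Function.Exact f g)
    {j : ℕ} {φ : CechCochain x M j} (hφ : φ ∈ cechCocycles x M j)
    (hgφ : cechCochainLinearMap x g j φ = 0) :
    ∃ φ' : cechCocycles x M' j, cechCochainLinearMap x f j φ' = φ := by
  obtain ⟨φ', rfl⟩ := (cechCochainLinearMap_exact x hfg j _).mp hgφ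
  refine ⟨⟨φ', cechCochainMap_injective (σ := RingHom.id R) (x := x) (y := x) (fun _ => rfl) hf _
    ?_⟩, rfl⟩
  exact (cechDifferential_cechCochainLinearMap x f j φ').symm.trans
    (Eq.trans hφ (map_zero _).symm)

/-- Čech cohomology of a short exact sequence is exact in the middle. -/
theorem cechCohomologyLinearMap_exact (hf : Function.Injective f) (hg : Function.Surjective g)
    (hfg : Function.Exact f g) (j : ℕ) :
    Function.Exact (cechCohomologyLinearMap x f j) (cechCohomologyLinearMap x g j) := by
  intro ξ
  obtain ⟨φ, rfl⟩ := Submodule.Quotient.mk_surjective _ ξ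
  rw [cechCohomologyLinearMap_mk_eq_zero]
  constructor
  · intro h
    cases j with
    | zero =>
      obtain ⟨φ', hφ'⟩ := exists_cechCocycle_of_mem_ker x hf hfg φ.2 h
      exact ⟨Submodule.Quotient.mk φ', congrArg Submodule.Quotient.mk (Subtype.ext hφ')⟩
    | succ j =>
      obtain ⟨ψ'', hψ⟩ := h
      obtain ⟨ψ, rfl⟩ := cechCochainMap_surjective (σ := RingHom.id R) (x := x) (y := x)
        (fun _ => rfl) hg j ψ''
      obtain ⟨φ', hφ'⟩ := exists_cechCocycle_of_mem_ker x hf hfg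
        (φ := φ.1 - cechDifferential x M j ψ)
        (sub_mem φ.2 (LinearMap.mem_ker.mpr (cechDifferential_comp x M j ψ)))
        (by rw [map_sub, sub_eq_zero, ← hψ]
            exact cechDifferential_cechCochainLinearMap x g j ψ)
      refine ⟨Submodule.Quotient.mk φ', ?_⟩
      rw [cechCohomologyLinearMap_mk, ← sub_eq_zero, ← Submodule.Quotient.mk_sub,
        cechCohomology_mk_eq_zero]
      refine ⟨-ψ, ?_⟩
      change _ = cechCochainLinearMap x f (j + 1) φ'.1 - φ.1
      rw [hφ', map_neg]
      abel
  · rintro ⟨ξ', hξ'⟩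
    obtain ⟨φ', rfl⟩ := Submodule.Quotient.mk_surjective _ ξ'
    rw [cechCohomologyLinearMap_mk, ← sub_eq_zero, ← Submodule.Quotient.mk_sub,
      cechCohomology_mk_eq_zero] at hξ'
    have h := cechCochainMap_mem_cechBoundaries (σ := RingHom.id R) (x := x) (y := x)
      (fun _ => rfl) g hξ'
    have h0 : cechCochainLinearMap x g j (cechCochainLinearMap x f j φ') = 0 :=
      (cechCochainLinearMap_exact x hfg j).apply_apply_eq_zero _
    have h1 : cechCochainLinearMap x g j (cechCochainLinearMap x f j φ' - φ) ∈
      cechBoundaries x M'' j := h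
    rwa [map_sub, h0, zero_sub, neg_mem_iff] at h1

theorem cechCohomologyLinearMap_zero_injective (hf : Function.Injective f) :
    Function.Injective (cechCohomologyLinearMap x f 0) := by
  refine (injective_iff_map_eq_zero _).mpr fun ξ hξ => ?_
  obtain ⟨φ, rfl⟩ := Submodule.Quotient.mk_surjective _ ξ
  have h : cechCochainLinearMap x f 0 φ = 0 := (cechCohomologyLinearMap_mk_eq_zero x f).mp hξ
  refine (cechCohomology_mk_eq_zero x).mpr ?_
  exact cechCochainMap_injective (σ := RingHom.id R) (x := x) (y := x) (fun _ => rfl) hf 0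
    (h.trans (map_zero _).symm)

/-- The graph of the connecting homomorphism `H^j(M'') → H^{j+1}(M')`. -/
def CechConnectingRel (f : M' →ₗ[R] M) (g : M →ₗ[R] M'') (j : ℕ) (ξ : CechCohomology x M'' j)
    (η : CechCohomology x M' (j + 1)) : Prop :=
  ∃ (φ : CechCochain x M j) (z : cechCocycles x M'' j) (w : cechCocycles x M' (j + 1)),
    cechCochainLinearMap x g j φ = z ∧
    cechDifferential x M j φ = cechCochainLinearMap x f (j + 1) w ∧
    Submodule.Quotient.mk z = ξ ∧ Submodule.Quotient.mk w = η

variable {x} in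
theorem CechConnectingRel.add {j : ℕ} {ξ₁ ξ₂ : CechCohomology x M'' j}
    {η₁ η₂ : CechCohomology x M' (j + 1)} (h₁ : CechConnectingRel x f g j ξ₁ η₁)
    (h₂ : CechConnectingRel x f g j ξ₂ η₂) : CechConnectingRel x f g j (ξ₁ + ξ₂) (η₁ + η₂) := by
  obtain ⟨φ, z, w, h1, h2, rfl, rfl⟩ := h₁
  obtain ⟨φ', z', w', h1', h2', rfl, rfl⟩ := h₂
  exact ⟨φ + φ', z + z', w + w', by rw [map_add, h1, h1', Submodule.coe_add],
    by rw [map_add, h2, h2', Submodule.coe_add, map_add], rfl, rfl⟩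

variable {x} in
theorem CechConnectingRel.smul {j : ℕ} {ξ : CechCohomology x M'' j}
    {η : CechCohomology x M' (j + 1)} (h : CechConnectingRel x f g j ξ η) (r : R) :
    CechConnectingRel x f g j (r • ξ) (r • η) := by
  obtain ⟨φ, z, w, h1, h2, rfl, rfl⟩ := h
  exact ⟨r • φ, r • z, r • w, by rw [map_smul, h1, Submodule.coe_smul],
    by rw [map_smul, h2, Submodule.coe_smul, map_smul], rfl, rfl⟩

variable {x} in
theorem CechConnectingRel.frobenius {p : ℕ} [Fact p.Prime] [CharP R p]
    {ρ' : M' →ₛₗ[_root_.frobenius R p] M'} {ρ : M →ₛₗ[_root_.frobenius R p] M}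
    {ρ'' : M'' →ₛₗ[_root_.frobenius R p] M''} (hf : Function.Semiconj f ρ' ρ)
    (hg : Function.Semiconj g ρ ρ'') {j : ℕ} {ξ : CechCohomology x M'' j}
    {η : CechCohomology x M' (j + 1)} (h : CechConnectingRel x f g j ξ η) :
    CechConnectingRel x f g j (cechCohomologyFrobenius x ρ'' j ξ)
      (cechCohomologyFrobenius x ρ' (j + 1) η) := by
  obtain ⟨φ, z, w, h1, h2, rfl, rfl⟩ := h
  refine ⟨cechCochainFrobenius x ρ j φ, cechCocycleFrobenius x ρ'' j z,
    cechCocycleFrobenius x ρ' (j + 1) w, ?_, ?_, rfl, rfl⟩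
  · refine (cechCochainMap_frobenius (σ := RingHom.id R) (fun _ => rfl) hg j φ).trans ?_
    exact congrArg _ h1
  · rw [cechDifferential_frobenius, h2]
    exact (cechCochainMap_frobenius (σ := RingHom.id R) (x := x) (y := x) (fun _ => rfl) hf
      (j + 1) w.1).symm

theorem CechConnectingRel.exists (hf : Function.Injective f) (hg : Function.Surjective g)
    (hfg : Function.Exact f g) {j : ℕ} (ξ : CechCohomology x M'' j) :
    ∃ η, CechConnectingRel x f g j ξ η := by
  obtain ⟨z, rfl⟩ := Submodule.Quotient.mk_surjective _ ξ
  obtain ⟨φ, hφ⟩ := cechCochainMap_surjective (σ := RingHom.id R) (x := x) (y := x)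
    (fun _ => rfl) hg j z
  obtain ⟨w, hw⟩ := exists_cechCocycle_of_mem_ker x hf hfg (φ := cechDifferential x M j φ)
    (LinearMap.mem_ker.mpr (cechDifferential_comp x M j φ)) (by
      rw [← cechDifferential_cechCochainLinearMap]
      exact (congrArg _ hφ).trans z.2)
  exact ⟨_, φ, z, w, hφ, hw.symm, rfl, rfl⟩

/-- This makes the connecting relation single-valued. A coboundary z has a lift ψ with dψ = 0; the
lift φ differs from ψ by a cochain coming from M', whose coboundary is w. -/
theorem CechConnectingRel.eq_zero (hf : Function.Injective f) (hg : Function.Surjective g)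
    (hfg : Function.Exact f g) {j : ℕ} {η : CechCohomology x M' (j + 1)}
    (h : CechConnectingRel x f g j 0 η) : η = 0 := by
  obtain ⟨φ, z, w, h1, h2, h3, rfl⟩ := h
  have hz : (z : CechCochain x M'' j) ∈ cechBoundaries x M'' j :=
    (cechCohomology_mk_eq_zero x).mp h3
  have key : ∃ ψ : CechCochain x M j, cechCochainLinearMap x g j ψ = z ∧
      cechDifferential x M j ψ = 0 := by
    cases j with
    | zero => exact ⟨0, (map_zero _).trans (Eq.symm hz), map_zero _⟩
    | succ j =>
      obtain ⟨ψ'', hψ⟩ := hz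
      obtain ⟨ψ, rfl⟩ := cechCochainMap_surjective (σ := RingHom.id R) (x := x) (y := x)
        (fun _ => rfl) hg j ψ''
      exact ⟨_, (cechDifferential_cechCochainLinearMap x g j ψ).symm.trans hψ,
        cechDifferential_comp x M j ψ⟩
  obtain ⟨ψ, hψ1, hψ2⟩ := key
  obtain ⟨φ', hφ'⟩ := (cechCochainLinearMap_exact x hfg j (φ - ψ)).mp
    (by rw [map_sub, h1, hψ1, sub_self])
  refine (cechCohomology_mk_eq_zero x).mpr ⟨φ', ?_⟩
  refine cechCochainMap_injective (σ := RingHom.id R) (x := x) (y := x) (fun _ => rfl) hf _ ?_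
  refine (cechDifferential_cechCochainLinearMap x f j φ').symm.trans ?_
  rw [hφ', map_sub, hψ2, sub_zero, h2]

/-- The connecting homomorphism in Čech cohomology: it is exact against `H^{j+1}(M') → H^{j+1}(M)`
and commutes with Frobenius actions. -/
theorem exists_cechConnecting (hf : Function.Injective f) (hg : Function.Surjective g)
    (hfg : Function.Exact f g) (j : ℕ) :
    ∃ δ : CechCohomology x M'' j →ₗ[R] CechCohomology x M' (j + 1),
      Function.Exact δ (cechCohomologyLinearMap x f (j + 1)) ∧
      ∀ (p : ℕ) [Fact p.Prime] [CharP R p] (ρ' : M' →ₛₗ[frobenius R p] M')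
        (ρ : M →ₛₗ[frobenius R p] M) (ρ'' : M'' →ₛₗ[frobenius R p] M''),
        Function.Semiconj f ρ' ρ → Function.Semiconj g ρ ρ'' →
        Function.Semiconj δ (cechCohomologyFrobenius x ρ'' j)
          (cechCohomologyFrobenius x ρ' (j + 1)) := by
  choose δ hδ using CechConnectingRel.exists x hf hg hfg (j := j)
  -- The relation is closed under linear combinations, so subtracting two values at ξ gives a value
  -- at 0. Linearity, exactness and equivariance of δ all come from this uniqueness.
  have huniq : ∀ {ξ η}, CechConnectingRel x f g j ξ η → δ ξ = η := by
    intro ξ η h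
    have h1 := (hδ ξ).add (h.smul (-1))
    rw [neg_one_smul, neg_one_smul, add_neg_cancel] at h1
    exact eq_of_sub_eq_zero ((sub_eq_add_neg _ _).trans (h1.eq_zero x hf hg hfg))
  refine ⟨{ toFun := δ
            map_add' := fun a b => huniq ((hδ a).add (hδ b))
            map_smul' := fun r a => huniq ((hδ a).smul r) }, ?_, ?_⟩
  · intro η
    constructor
    · intro h
      obtain ⟨w, rfl⟩ := Submodule.Quotient.mk_surjective _ η
      obtain ⟨φ, hφ⟩ := (cechCohomologyLinearMap_mk_eq_zero x f).mp h
      have hz : cechCochainLinearMap x g j φ ∈ cechCocycles x M'' j := by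
        rw [cechCocycles, LinearMap.mem_ker, cechDifferential_cechCochainLinearMap, hφ]
        exact (cechCochainLinearMap_exact x hfg (j + 1)).apply_apply_eq_zero _
      exact ⟨Submodule.Quotient.mk ⟨_, hz⟩, huniq ⟨φ, ⟨_, hz⟩, w, rfl, hφ, rfl, rfl⟩⟩
    · rintro ⟨ξ, rfl⟩
      obtain ⟨φ, z, w, -, h2, -, h4⟩ := hδ ξ
      change cechCohomologyLinearMap x f (j + 1) (δ ξ) = 0
      rw [← h4, cechCohomologyLinearMap_mk_eq_zero]
      exact ⟨φ, h2⟩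
  · intro p _ _ ρ' ρ ρ'' hfρ hgρ ξ
    exact huniq ((hδ ξ).frobenius hfρ hgρ)

end LongExact

/-! ### Čech cohomology is torsion -/

section CechTorsion

variable {R : Type*} [CommRing R] {M : Type*} [AddCommGroup M] [Module R M]

/-- M_a → M_{ac} is localization at c, so its kernel is c-power torsion; the next lemma says the
same of its cokernel. -/
theorem exists_pow_smul_eq_zero_of_awayRestriction_eq_zero {a b c : R} (hb : b = a * c) (h : a ∣ b)
    {z : LocalizedModule (Submonoid.powers a) M} (hz : awayRestriction M h z = 0) :
    ∃ k : ℕ, c ^ k • z = 0 := by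
  induction z using LocalizedModule.induction_on with | _ m s
  obtain ⟨_, l, rfl⟩ := s
  have h1 := (awayRestriction_mk hb h m l).symm.trans hz
  obtain ⟨k, hk⟩ := localizedModule_mk_eq_zero.mp h1
  refine ⟨k + l, ?_⟩
  rw [LocalizedModule.smul'_mk, localizedModule_mk_eq_zero]
  refine ⟨k, ?_⟩
  rw [← hk, hb, smul_smul, smul_smul]
  ring_nf

theorem exists_awayRestriction_eq_pow_smul {a b c : R} (hb : b = a * c) (h : a ∣ b)
    (w : LocalizedModule (Submonoid.powers b) M) :
    ∃ k : ℕ, ∃ z, awayRestriction M h z = c ^ k • w := by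
  induction w using LocalizedModule.induction_on with | _ m s
  obtain ⟨_, k, rfl⟩ := s
  refine ⟨k, LocalizedModule.mk m ⟨a ^ k, k, rfl⟩, ?_⟩
  rw [LocalizedModule.smul'_mk]
  exact awayRestriction_mk hb h m k

variable {n : ℕ} (x : Fin n → R) (i : Fin n)

theorem prod_cons_eq {j : ℕ} (s : Fin j → Fin n) :
    ∏ k, x ((Fin.cons i s : Fin (j + 1) → Fin n) k) = (∏ k, x (s k)) * x i := by
  rw [Fin.prod_univ_succ, mul_comm]
  simp

theorem prod_dvd_prod_cons {j : ℕ} (s : Fin j → Fin n) :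
    (∏ k, x (s k)) ∣ ∏ k, x ((Fin.cons i s : Fin (j + 1) → Fin n) k) :=
  ⟨x i, prod_cons_eq x i s⟩

variable {x} in
theorem awayRestriction_congr {j : ℕ} (φ : CechCochain x M j) {t t' : Fin j → Fin n} (h : t = t')
    {b : R} (ht : (∏ k, x (t k)) ∣ b) (ht' : (∏ k, x (t' k)) ∣ b) :
    awayRestriction M ht (φ t) = awayRestriction M ht' (φ t') := by
  subst h
  rfl

variable {x} in
/-- After restriction to the charts containing `x i`, each cocycle is the coboundary of its
contraction with `i`. -/
theorem awayRestriction_cons_eq_sum {j : ℕ} {φ : CechCochain x M (j + 1)}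
    (hφ : cechDifferential x M (j + 1) φ = 0) (s : Fin (j + 1) → Fin n) :
    awayRestriction M (prod_dvd_prod_cons x i s) (φ s) =
      ∑ l : Fin (j + 1), (-1 : R) ^ (l : ℕ) • awayRestriction M
        (show (∏ k, x ((Fin.cons i (fun k => s (l.succAbove k)) : Fin (j + 1) → Fin n) k)) ∣
          ∏ k, x ((Fin.cons i s : Fin (j + 2) → Fin n) k) by
          rw [prod_cons_eq, prod_cons_eq]
          exact mul_dvd_mul_right (prod_face_dvd x s l) _)
        (φ (Fin.cons i fun k => s (l.succAbove k))) := by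
  -- Evaluate the cocycle condition at (i, s₀, …, s_j): the face omitting i gives φ(s), and the
  -- other faces still begin with i, with signs shifted by one.
  have h := congrFun hφ (Fin.cons i s)
  rw [cechDifferential_apply, Fin.sum_univ_succ, Pi.zero_apply, Fin.val_zero, pow_zero, one_smul,
    add_eq_zero_iff_eq_neg, ← Finset.sum_neg_distrib] at h
  refine (awayRestriction_congr φ ?_ _ _).trans (h.trans (Finset.sum_congr rfl fun l _ => ?_))
  · funext k
    simp
  · rw [Fin.val_succ, pow_succ, mul_neg_one, neg_smul, neg_neg]
    congr 1
    refine awayRestriction_congr φ ?_ _ _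
    funext k
    refine Fin.cases ?_ (fun k => ?_) k <;> simp

variable {x} in
-- Contraction with i is a homotopy only after inverting x_i. Multiplying by a power of x_i clears
-- these denominators and gives a genuine cochain ψ, whose coboundary agrees with x_i^K φ up to
-- x_i-power torsion.
theorem exists_cechBoundary_awayRestriction_eq {j : ℕ} {φ : CechCochain x M j}
    (hφ : cechDifferential x M j φ = 0) : ∃ K : ℕ, ∃ β ∈ cechBoundaries x M j,
      ∀ s, awayRestriction M (prod_dvd_prod_cons x i s) ((x i ^ K • φ - β) s) = 0 := by
  cases j with
  | zero =>
    refine ⟨0, 0, zero_mem _, fun s => ?_⟩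
    have h := congrFun hφ (Fin.cons i s)
    rw [cechDifferential_apply, Fin.sum_univ_succ, Pi.zero_apply, Fin.val_zero, pow_zero, one_smul,
      Fin.sum_univ_zero, add_zero] at h
    rw [pow_zero, one_smul, sub_zero]
    exact (awayRestriction_congr φ (Subsingleton.elim _ _) _ _).trans h
  | succ j =>
    choose k z hz using fun t : Fin j → Fin n => exists_awayRestriction_eq_pow_smul
      (prod_cons_eq x i t) (prod_dvd_prod_cons x i t) (φ (Fin.cons i t))
    -- There are finitely many index tuples, so one exponent clears all denominators.
    let K := Finset.univ.sup k
    obtain ⟨ψ, hψ⟩ : ∃ ψ : CechCochain x M j, ∀ t,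
        awayRestriction M (prod_dvd_prod_cons x i t) (ψ t) = x i ^ K • φ (Fin.cons i t) := by
      refine ⟨fun t => x i ^ (K - k t) • z t, fun t => ?_⟩
      rw [map_smul, hz, smul_smul, ← pow_add,
        Nat.sub_add_cancel (Finset.le_sup (f := k) (Finset.mem_univ t))]
    refine ⟨K, cechDifferential x M j ψ, ⟨ψ, rfl⟩, fun s => ?_⟩
    rw [Pi.sub_apply, Pi.smul_apply, map_sub, map_smul, awayRestriction_cons_eq_sum i hφ,
      cechDifferential_apply, map_sum, Finset.smul_sum, ← Finset.sum_sub_distrib]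
    refine Finset.sum_eq_zero fun l _ => ?_
    have hdvd : (∏ k, x ((Fin.cons i (fun k => s (l.succAbove k)) : Fin (j + 1) → Fin n) k)) ∣
        ∏ k, x ((Fin.cons i s : Fin (j + 2) → Fin n) k) := by
      rw [prod_cons_eq, prod_cons_eq]
      exact mul_dvd_mul_right (prod_face_dvd x s l) _
    have h := congrArg (awayRestriction M hdvd) (hψ fun k => s (l.succAbove k))
    rw [awayRestriction_comp, map_smul] at h
    rw [map_smul, awayRestriction_comp, smul_comm, ← h, sub_self]

/-- Each element of the sequence `x` acts locally nilpotently on Čech cohomology. -/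
theorem exists_pow_smul_cechCohomology_eq_zero {j : ℕ} (ξ : CechCohomology x M j) :
    ∃ k : ℕ, x i ^ k • ξ = 0 := by
  obtain ⟨φ, rfl⟩ := Submodule.Quotient.mk_surjective _ ξ
  obtain ⟨K, β, hβ, h⟩ := exists_cechBoundary_awayRestriction_eq i φ.2
  choose l hl using fun s => exists_pow_smul_eq_zero_of_awayRestriction_eq_zero
    (prod_cons_eq x i s) (prod_dvd_prod_cons x i s) (h s)
  let L := Finset.univ.sup l
  have hL : x i ^ L • (x i ^ K • φ.1 - β) = 0 := by
    funext s
    have hle : l s ≤ L := Finset.le_sup (f := l) (Finset.mem_univ s)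
    rw [Pi.smul_apply, ← Nat.sub_add_cancel hle, pow_add,
      mul_smul, hl, smul_zero, Pi.zero_apply]
  refine ⟨L + K, ?_⟩
  rw [← Submodule.Quotient.mk_smul, cechCohomology_mk_eq_zero]
  have h1 : x i ^ (L + K) • φ.1 = x i ^ L • β := by
    rw [pow_add, mul_smul, ← sub_eq_zero, ← smul_sub, hL]
  change x i ^ (L + K) • φ.1 ∈ cechBoundaries x M j
  exact h1 ▸ Submodule.smul_mem _ _ hβ

end CechTorsion

/-! ### Čech cohomology of finite modules is Artinian -/

section CechArtinian

variable {R : Type*} [CommRing R] {n : ℕ} (x : Fin n → R)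

theorem cechCohomologyLinearMap_lsmul {M : Type*} [AddCommGroup M] [Module R M] (r : R) (j : ℕ)
    (ξ : CechCohomology x M j) :
    cechCohomologyLinearMap x (LinearMap.lsmul R M r) j ξ = r • ξ := by
  obtain ⟨φ, rfl⟩ := Submodule.Quotient.mk_surjective _ ξ
  rw [cechCohomologyLinearMap_mk, ← Submodule.Quotient.mk_smul]
  congr 1
  refine Subtype.ext (funext fun s => ?_)
  change localizedAwayMap (σ := RingHom.id R) _ (map_prod_comp_eq (fun _ => rfl) s) (φ.1 s) =
    r • φ.1 s
  induction φ.1 s using LocalizedModule.induction_on with | _ m t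
  rw [localizedAwayMap_mk, LocalizedModule.smul'_mk]
  rfl

theorem isArtinian_cechCohomology_of_exact {M' M M'' : Type*} [AddCommGroup M'] [Module R M']
    [AddCommGroup M] [Module R M] [AddCommGroup M''] [Module R M''] {f : M' →ₗ[R] M}
    {g : M →ₗ[R] M''} (hf : Function.Injective f) (hg : Function.Surjective g)
    (hfg : Function.Exact f g) (j : ℕ) (h' : IsArtinian R (CechCohomology x M' j))
    (h'' : IsArtinian R (CechCohomology x M'' j)) : IsArtinian R (CechCohomology x M j) :=
  isArtinian_of_range_eq_ker _ _
    (LinearMap.exact_iff.mp (cechCohomologyLinearMap_exact x hf hg hfg j)).symm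

/-- By the long exact sequence of multiplication by x_i, its kernel on H^j(M) is the image of
H^{j-1}(M/x_i M), or zero for j = 0. Melkersson's criterion does the rest. -/
theorem isArtinian_cechCohomology_of_isSMulRegular {M : Type*} [AddCommGroup M] [Module R M]
    (i : Fin n) (hreg : Function.Injective (LinearMap.lsmul R M (x i)))
    (h : ∀ j, IsArtinian R
      (CechCohomology x (M ⧸ LinearMap.range (LinearMap.lsmul R M (x i))) j)) (j : ℕ) :
    IsArtinian R (CechCohomology x M j) := by
  refine isArtinian_of_isArtinian_ker_lsmul (x i)
    (exists_pow_smul_cechCohomology_eq_zero x i) ?_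
  have hker : LinearMap.ker (LinearMap.lsmul R (CechCohomology x M j) (x i)) =
      LinearMap.ker (cechCohomologyLinearMap x (LinearMap.lsmul R M (x i)) j) := by
    ext ξ
    rw [LinearMap.mem_ker, LinearMap.mem_ker, cechCohomologyLinearMap_lsmul]
    rfl
  rw [hker]
  cases j with
  | zero =>
    rw [LinearMap.ker_eq_bot.mpr (cechCohomologyLinearMap_zero_injective x hreg)]
    infer_instance
  | succ j =>
    obtain ⟨δ, hδ, -⟩ := exists_cechConnecting x hreg
      (Submodule.mkQ_surjective (LinearMap.range (LinearMap.lsmul R M (x i))))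
      (LinearMap.exact_map_mkQ_range _) j
    rw [LinearMap.exact_iff.mp hδ]
    have := h j
    exact isArtinian_of_surjective _ δ.rangeRestrict δ.surjective_rangeRestrict

/-- Each localization M_a is a quotient of M: it is M itself when a is a unit and 0 otherwise.
Cochains are finite products of these. -/
theorem isArtinian_cechCohomology_of_maximal_smul_eq_zero [IsLocalRing R] {M : Type*}
    [AddCommGroup M] [Module R M] [IsArtinian R M]
    (h : ∀ r ∈ IsLocalRing.maximalIdeal R, ∀ m : M, r • m = 0) (j : ℕ) :
    IsArtinian R (CechCohomology x M j) := by
  have hloc : ∀ a : R, IsArtinian R (LocalizedModule (Submonoid.powers a) M) := by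
    intro a
    refine isArtinian_of_surjective M (LocalizedModule.mkLinearMap (Submonoid.powers a) M) ?_
    intro z
    induction z using LocalizedModule.induction_on with | _ m s
    obtain ⟨_, k, rfl⟩ := s
    by_cases ha : IsUnit a
    · obtain ⟨u, hu⟩ := (ha.pow k).exists_left_inv
      refine ⟨u • m, LocalizedModule.mk_eq.mpr ⟨1, ?_⟩⟩
      simp [Submonoid.smul_def, smul_smul, mul_comm, hu]
    · refine ⟨0, ?_⟩
      rw [map_zero, eq_comm, localizedModule_mk_eq_zero]
      exact ⟨1, by rw [pow_one]; exact h a ((IsLocalRing.mem_maximalIdeal a).mpr ha) m⟩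
  infer_instance

/-- Čech cohomology of a finite module, with respect to generators of the maximal ideal of a
Noetherian local ring, is Artinian. -/
theorem isArtinian_cechCohomology [IsNoetherianRing R] [IsLocalRing R]
    (hx : Ideal.span (Set.range x) = IsLocalRing.maximalIdeal R) (M : Type*) [AddCommGroup M]
    [Module R M] [hM : Module.Finite R M] (j : ℕ) : IsArtinian R (CechCohomology x M j) := by
  -- Noetherian induction on an ideal killing the module: the claim may be assumed for modules
  -- killed by a strictly larger ideal.
  suffices H : ∀ I : Ideal R, ∀ (N : Type _) [AddCommGroup N] [Module R N] [Module.Finite R N],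
      (∀ r ∈ I, ∀ m : N, r • m = 0) → ∀ j, IsArtinian R (CechCohomology x N j) from
    H ⊥ M (fun r hr m => by rw [(Submodule.mem_bot R).mp hr, zero_smul]) j
  intro I
  induction I using IsNoetherian.induction with | _ I IH
  intro N _ _ hN
  induction hN using IsNoetherianRing.induction_on_isQuotientEquivQuotientPrime R with
  | subsingleton N =>
    intro _ j
    have : Subsingleton (CechCohomology x N j) := by
      have : Subsingleton (CechCochain x N j) := ⟨fun φ ψ => funext fun s => by
        have h0 : ∀ z : LocalizedModule (Submonoid.powers (∏ k, x (s k))) N, z = 0 := fun z => by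
          induction z using LocalizedModule.induction_on with | _ m t
          rw [Subsingleton.elim m 0, LocalizedModule.zero_mk]
        rw [h0 (φ s), h0 (ψ s)]⟩
      exact (Submodule.Quotient.mk_surjective _).subsingleton
    infer_instance
  | exact N₁ N₂ N₃ f g hf hg hfg h₁ h₃ =>
    intro hI j
    refine isArtinian_cechCohomology_of_exact x hf hg hfg j (h₁ (fun r hr m => hf ?_) j)
      (h₃ (fun r hr m => ?_) j)
    · rw [map_smul, hI r hr, map_zero]
    · obtain ⟨m, rfl⟩ := hg m
      rw [← map_smul, hI r hr, map_zero]
  | quotient N P e =>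
    intro hI
    have hP : ∀ r, (∀ m : N, r • m = 0) ↔ r ∈ P.1 := by
      intro r
      constructor
      · intro h
        have h1 := congrArg e (h (e.symm 1))
        rw [map_smul, e.apply_symm_apply, map_zero] at h1
        rw [← Ideal.Quotient.eq_zero_iff_mem]
        simpa [Algebra.smul_def] using h1
      · intro hr m
        apply e.injective
        obtain ⟨s, hs⟩ := Ideal.Quotient.mk_surjective (e m)
        rw [map_smul, map_zero, ← hs, Algebra.smul_def, Ideal.Quotient.algebraMap_eq,
          Ideal.Quotient.eq_zero_iff_mem.mpr hr, zero_mul]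
    have hIP : I ≤ P.1 := fun r hr => (hP r).mp (hI r hr)
    -- R/P is killed by P, so the induction hypothesis applies unless I = P.
    rcases hIP.lt_or_eq with hlt | rfl
    · exact IH P.1 hlt N fun r hr => (hP r).mpr hr
    by_cases hall : ∀ i, x i ∈ P.1
    · have hle : IsLocalRing.maximalIdeal R ≤ P.1 := by
        rw [← hx, Ideal.span_le]
        rintro _ ⟨i, rfl⟩
        exact hall i
      have hkill : ∀ r ∈ IsLocalRing.maximalIdeal R, ∀ m : N, r • m = 0 :=
        fun r hr => (hP r).mpr (hle hr)
      have : IsArtinian R N := by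
        have hT : Module.IsTorsionBySet R N (IsLocalRing.maximalIdeal R : Set R) :=
          fun m r => hkill r r.2 m
        let := hT.module
        let := Ideal.Quotient.field (IsLocalRing.maximalIdeal R)
        have h1 : IsSemisimpleModule (R ⧸ IsLocalRing.maximalIdeal R) N := inferInstance
        have : IsSemisimpleModule R N := hT.isSemisimpleModule_iff.mp h1
        infer_instance
      exact isArtinian_cechCohomology_of_maximal_smul_eq_zero x hkill
    · push Not at hall
      obtain ⟨i, hi⟩ := hall
      refine isArtinian_cechCohomology_of_isSMulRegular x i ?_ ?_
      · refine (injective_iff_map_eq_zero _).mpr fun m hm => e.injective ?_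
        obtain ⟨s, hs⟩ := Ideal.Quotient.mk_surjective (e m)
        have h1 : x i • e m = 0 := by
          rw [← map_smul, map_eq_zero_iff e e.injective]
          exact hm
        rw [← hs, Algebra.smul_def, Ideal.Quotient.algebraMap_eq, ← map_mul,
          Ideal.Quotient.eq_zero_iff_mem] at h1
        rw [map_zero, ← hs, Ideal.Quotient.eq_zero_iff_mem]
        exact (P.2.mem_or_mem h1).resolve_left hi
      -- The quotient by x_i is killed by P + (x_i), which is strictly larger than P because x_i ∉
      -- P.
      · refine IH (P.1 ⊔ Ideal.span {x i}) (lt_of_le_of_ne le_sup_left fun h => hi ?_) _ ?_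
        · rw [h]
          exact Ideal.mem_sup_right (Ideal.mem_span_singleton_self _)
        · intro r hr m
          obtain ⟨m, rfl⟩ := Submodule.Quotient.mk_surjective _ m
          obtain ⟨a, ha, b, hb, rfl⟩ := Submodule.mem_sup.mp hr
          obtain ⟨c, rfl⟩ := Ideal.mem_span_singleton'.mp hb
          rw [← Submodule.Quotient.mk_smul, Submodule.Quotient.mk_eq_zero, add_smul, hI a ha,
            zero_add]
          exact ⟨c • m, by rw [LinearMap.lsmul_apply, smul_smul, mul_comm]⟩

end CechArtinian

/-! ### Rings that are a union of two closed subschemes -/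

section TwoIdeals

/-- The Frobenius map of an `R`-algebra `S`, as a Frobenius action on the `R`-module `S`. -/
def algebraFrobeniusAction (p : ℕ) [Fact p.Prime] (R S : Type*) [CommRing R] [CharP R p]
    [CommRing S] [CharP S p] [Algebra R S] : S →ₛₗ[frobenius R p] S where
  toFun := frobenius S p
  map_add' := map_add _
  map_smul' r s := by simp [Algebra.smul_def, frobenius_def, mul_pow]

/-- The Frobenius map of `R`, restricted to an ideal. -/
def idealFrobeniusAction (p : ℕ) [Fact p.Prime] {R : Type*} [CommRing R] [CharP R p]
    (I : Ideal R) : I →ₛₗ[frobenius R p] I where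
  toFun r := ⟨frobenius R p r, I.pow_mem_of_mem r.2 p (Fact.out : p.Prime).pos⟩
  map_add' _ _ := Subtype.ext (map_add (frobenius R p) _ _)
  map_smul' _ _ := Subtype.ext (map_mul (frobenius R p) _ _)

variable {R : Type*} [CommRing R] {p : ℕ} [Fact p.Prime] [CharP R p]

/-- The identity of `R ⧸ I`, as a semilinear map from the `R`-module `R ⧸ I` to the
`R ⧸ I`-module `R ⧸ I`. -/
def quotientIdSemilinear (I : Ideal R) : (R ⧸ I) →ₛₗ[Ideal.Quotient.mk I] (R ⧸ I) where
  toFun := id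
  map_add' _ _ := rfl
  map_smul' _ _ := Algebra.smul_def _ _

variable {n : ℕ} {x : Fin n → R}

theorem span_range_quotient_mk_eq_maximalIdeal [IsLocalRing R]
    (hx : Ideal.span (Set.range x) = IsLocalRing.maximalIdeal R) (I : Ideal R)
    [IsLocalRing (R ⧸ I)] :
    Ideal.span (Set.range fun i => Ideal.Quotient.mk I (x i)) =
      IsLocalRing.maximalIdeal (R ⧸ I) := by
  rw [← IsLocalRing.map_maximalIdeal_of_surjective _ (Ideal.Quotient.mk_surjective (I := I)), ← hx,
    Ideal.map_span, ← Set.range_comp]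
  rfl

/-- The hypothesis concerns Čech cohomology over R/I for the images of x. The identity of R/I,
semilinear along R → R/I, carries it to cohomology over R for x itself. -/
theorem IsWeaklyFNilpotent.isNilpotentAction_quotient [IsLocalRing R]
    (hx : Ideal.span (Set.range x) = IsLocalRing.maximalIdeal R) {I : Ideal R} [CharP (R ⧸ I) p]
    (h : IsWeaklyFNilpotent p (R ⧸ I)) {j : ℕ} (hj : (j : WithBot ℕ∞) < ringKrullDim (R ⧸ I)) :
    IsNilpotentAction (cechCohomologyFrobenius x (algebraFrobeniusAction p R (R ⧸ I)) j) := by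
  have := h.isLocalRing
  exact IsNilpotentAction.of_bijective
    (cechCohomologyMap_frobenius (x := x) (fun _ => rfl) (g := quotientIdSemilinear I)
      (fun _ => rfl) j)
    (cechCohomologyMap_bijective _ Function.bijective_id j)
    (h.nilpotent n _ (span_range_quotient_mk_eq_maximalIdeal hx I) j hj)

theorem IsGeneralizedWeaklyFNilpotent.isGeneralizedNilpotentAction_quotient [IsLocalRing R]
    (hx : Ideal.span (Set.range x) = IsLocalRing.maximalIdeal R) {I : Ideal R} [CharP (R ⧸ I) p]
    (h : IsGeneralizedWeaklyFNilpotent p (R ⧸ I)) {j : ℕ}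
    (hj : (j : WithBot ℕ∞) < ringKrullDim (R ⧸ I)) :
    IsGeneralizedNilpotentAction
      (cechCohomologyFrobenius x (algebraFrobeniusAction p R (R ⧸ I)) j) := by
  have := h.isLocalRing
  have : RingHomSurjective (Ideal.Quotient.mk I) := ⟨Ideal.Quotient.mk_surjective⟩
  exact IsGeneralizedNilpotentAction.of_bijective
    (cechCohomologyMap_frobenius (x := x) (fun _ => rfl) (g := quotientIdSemilinear I)
      (fun _ => rfl) j)
    (cechCohomologyMap_bijective _ Function.bijective_id j)
    (h.generalizedNilpotent n _ (span_range_quotient_mk_eq_maximalIdeal hx I) j hj)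

end TwoIdeals

/-! ### Passing from R/a₁, R/a₂ and R/(a₁ + a₂) to R -/

section MayerVietoris

universe u

/-- A property of Frobenius actions is middle-closed if, in an exact sequence `A → M → B` of modules
with Frobenius action with `M` Artinian, it passes from `A` and `B` to `M`. -/
def IsMiddleClosed {R : Type u} [CommRing R] {p : ℕ} [Fact p.Prime] [CharP R p]
    (P : ∀ (M : Type u) [AddCommGroup M] [Module R M], (M →ₛₗ[frobenius R p] M) → Prop) : Prop :=
  ∀ (A M B : Type u) [AddCommGroup A] [Module R A] [AddCommGroup M] [Module R M]
    [AddCommGroup B] [Module R B] [IsArtinian R M] (ρA : A →ₛₗ[frobenius R p] A)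
    (ρM : M →ₛₗ[frobenius R p] M) (ρB : B →ₛₗ[frobenius R p] B) (f : A →ₗ[R] M) (g : M →ₗ[R] B),
    Function.Exact f g → Function.Semiconj f ρA ρM → Function.Semiconj g ρM ρB →
    P A ρA → P B ρB → P M ρM

variable {R : Type u} [CommRing R] [IsNoetherianRing R] [IsLocalRing R] {p : ℕ} [Fact p.Prime]
  [CharP R p] {n : ℕ} {x : Fin n → R}
  {P : ∀ (M : Type u) [AddCommGroup M] [Module R M], (M →ₛₗ[frobenius R p] M) → Prop}

/-- A middle-closed property of Frobenius actions holds for `H^j(M)` if it holds for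
`H^j(M')` and `H^j(M'')`. -/
theorem cechCohomologyFrobenius_middle
    (hP : IsMiddleClosed P) (hx : Ideal.span (Set.range x) = IsLocalRing.maximalIdeal R)
    {M' M M'' : Type u} [AddCommGroup M'] [Module R M'] [AddCommGroup M] [Module R M]
    [Module.Finite R M] [AddCommGroup M''] [Module R M''] {f : M' →ₗ[R] M} {g : M →ₗ[R] M''}
    (hf : Function.Injective f) (hg : Function.Surjective g) (hfg : Function.Exact f g)
    {ρ' : M' →ₛₗ[frobenius R p] M'} {ρ : M →ₛₗ[frobenius R p] M}
    {ρ'' : M'' →ₛₗ[frobenius R p] M''} (hfρ : Function.Semiconj f ρ' ρ)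
    (hgρ : Function.Semiconj g ρ ρ'') (j : ℕ) (h' : P _ (cechCohomologyFrobenius x ρ' j))
    (h'' : P _ (cechCohomologyFrobenius x ρ'' j)) : P _ (cechCohomologyFrobenius x ρ j) := by
  have := isArtinian_cechCohomology x hx M j
  exact hP _ _ _ _ _ _ _ _ (cechCohomologyLinearMap_exact x hf hg hfg j)
    (cechCohomologyMap_frobenius _ hfρ j) (cechCohomologyMap_frobenius _ hgρ j) h' h''

/-- A middle-closed property of Frobenius actions holds for `H^j(M')` if it holds for
`H^{j-1}(M'')` and `H^j(M)`. -/
theorem cechCohomologyFrobenius_left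
    (hP : IsMiddleClosed P) (hx : Ideal.span (Set.range x) = IsLocalRing.maximalIdeal R)
    {M' M M'' : Type u} [AddCommGroup M'] [Module R M'] [Module.Finite R M'] [AddCommGroup M]
    [Module R M] [AddCommGroup M''] [Module R M''] {f : M' →ₗ[R] M} {g : M →ₗ[R] M''}
    (hf : Function.Injective f) (hg : Function.Surjective g) (hfg : Function.Exact f g)
    {ρ' : M' →ₛₗ[frobenius R p] M'} {ρ : M →ₛₗ[frobenius R p] M}
    {ρ'' : M'' →ₛₗ[frobenius R p] M''} (hfρ : Function.Semiconj f ρ' ρ)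
    (hgρ : Function.Semiconj g ρ ρ'') (j : ℕ)
    (h'' : ∀ i, i + 1 = j → P _ (cechCohomologyFrobenius x ρ'' i))
    (h : P _ (cechCohomologyFrobenius x ρ j)) : P _ (cechCohomologyFrobenius x ρ' j) := by
  have := isArtinian_cechCohomology x hx M' j
  cases j with
  | zero =>
    -- In degree 0 the second map is injective, so the first may be zero. Its source is H^0(M), for
    -- which `P` is known; `P` is not assumed for the zero module.
    refine hP _ _ _ (cechCohomologyFrobenius x ρ 0) _ _ 0 (cechCohomologyLinearMap x f 0) ?_ ?_
      (cechCohomologyMap_frobenius _ hfρ 0) h h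
    · rw [LinearMap.exact_iff, LinearMap.range_zero, LinearMap.ker_eq_bot]
      exact cechCohomologyLinearMap_zero_injective x hf
    · exact fun _ => (map_zero _).symm
  | succ j =>
    obtain ⟨δ, hδ, hδρ⟩ := exists_cechConnecting x hf hg hfg j
    exact hP _ _ _ _ _ _ δ _ hδ (hδρ p ρ' ρ ρ'' hfρ hgρ)
      (cechCohomologyMap_frobenius _ hfρ (j + 1)) (h'' j rfl) h

/-- This is a Mayer–Vietoris argument through a₁: first as a submodule of R/a₂ with quotient R/(a₁ +
a₂), then as a submodule of R with quotient R/a₁. -/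
theorem cechCohomologyFrobenius_of_inf_eq_bot (hP : IsMiddleClosed P)
    (hx : Ideal.span (Set.range x) = IsLocalRing.maximalIdeal R) {a₁ a₂ : Ideal R}
    (ha : a₁ ⊓ a₂ = ⊥) [CharP (R ⧸ a₁) p] [CharP (R ⧸ a₂) p] [CharP (R ⧸ (a₁ ⊔ a₂)) p] (j : ℕ)
    (h₁ : P _ (cechCohomologyFrobenius x (algebraFrobeniusAction p R (R ⧸ a₁)) j))
    (h₂ : P _ (cechCohomologyFrobenius x (algebraFrobeniusAction p R (R ⧸ a₂)) j))
    (hb : ∀ i, i + 1 = j →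
      P _ (cechCohomologyFrobenius x (algebraFrobeniusAction p R (R ⧸ (a₁ ⊔ a₂))) i)) :
    P _ (cechCohomologyFrobenius x (frobeniusAction p R) j) := by
  have key : P _ (cechCohomologyFrobenius x (idealFrobeniusAction p a₁) j) := by
    refine cechCohomologyFrobenius_left hP hx
      (f := (Ideal.Quotient.mkₐ R a₂).toLinearMap ∘ₗ a₁.subtype)
      (g := (Ideal.Quotient.factorₐ R (le_sup_right : a₂ ≤ a₁ ⊔ a₂)).toLinearMap)
      ?_ ?_ ?_ (fun r => map_pow (Ideal.Quotient.mk a₂) _ _)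
      (fun r => map_pow (Ideal.Quotient.factor (le_sup_right : a₂ ≤ a₁ ⊔ a₂)) _ _) j hb h₂
    · refine (injective_iff_map_eq_zero _).mpr fun r hr => Subtype.ext ?_
      have h2 : (r : R) ∈ a₂ := Ideal.Quotient.eq_zero_iff_mem.mp hr
      exact (Submodule.mem_bot R).mp (ha ▸ ⟨r.2, h2⟩)
    · exact Ideal.Quotient.factor_surjective le_sup_right
    · intro z
      obtain ⟨r, rfl⟩ := Ideal.Quotient.mk_surjective z
      change Ideal.Quotient.mk (a₁ ⊔ a₂) r = 0 ↔ _
      rw [Ideal.Quotient.eq_zero_iff_mem, Submodule.mem_sup]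
      constructor
      · rintro ⟨b, hb, c, hc, rfl⟩
        refine ⟨⟨b, hb⟩, ?_⟩
        change Ideal.Quotient.mk a₂ b = Ideal.Quotient.mk a₂ (b + c)
        rw [map_add, Ideal.Quotient.eq_zero_iff_mem.mpr hc, add_zero]
      · rintro ⟨b, hb⟩
        have hb' : Ideal.Quotient.mk a₂ r = Ideal.Quotient.mk a₂ b := hb.symm
        exact ⟨b, b.2, r - b, Ideal.Quotient.eq.mp hb', by ring⟩
  refine cechCohomologyFrobenius_middle hP hx (f := a₁.subtype)
    (g := (Ideal.Quotient.mkₐ R a₁).toLinearMap) a₁.injective_subtype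
    Ideal.Quotient.mk_surjective ?_ (fun _ => rfl) (fun r => map_pow (Ideal.Quotient.mk a₁) _ _) j
    key h₁
  intro r
  change Ideal.Quotient.mk a₁ r = 0 ↔ _
  rw [Ideal.Quotient.eq_zero_iff_mem]
  exact ⟨fun h => ⟨⟨r, h⟩, rfl⟩, fun ⟨s, hs⟩ => hs ▸ s.2⟩

end MayerVietoris

theorem mainTheorem1 {R : Type*} [CommRing R] [IsNoetherianRing R] [IsLocalRing R]
    (p : ℕ) [Fact p.Prime] [CharP R p] (hF : (frobenius R p).Finite)
    (d : ℕ) (hd : 2 ≤ d) (hdim : ringKrullDim R = d)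
    (a₁ a₂ : Ideal R) (ha : a₁ ⊓ a₂ = ⊥)
    (hdim₁ : ringKrullDim (R ⧸ a₁) = d) (hdim₂ : ringKrullDim (R ⧸ a₂) = d)
    (hdimb : ((d - 1 : ℕ) : WithBot ℕ∞) ≤ ringKrullDim (R ⧸ (a₁ ⊔ a₂))) :
    (IsWeaklyFNilpotent p (R ⧸ a₁) → IsWeaklyFNilpotent p (R ⧸ a₂) →
      IsWeaklyFNilpotent p (R ⧸ (a₁ ⊔ a₂)) → IsWeaklyFNilpotent p R) ∧
    (IsEquidimensionalRing R → IsGeneralizedWeaklyFNilpotent p (R ⧸ a₁) →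
      IsGeneralizedWeaklyFNilpotent p (R ⧸ a₂) →
      IsGeneralizedWeaklyFNilpotent p (R ⧸ (a₁ ⊔ a₂)) →
      IsGeneralizedWeaklyFNilpotent p R) := by
  -- The connecting map raises degree by one, so R/(a₁ + a₂) is needed only in degrees i < d - 1;
  -- this is why dimension d - 1 suffices for it.
  have hlt : ∀ {j : ℕ}, (j : WithBot ℕ∞) < ringKrullDim R → ∀ i, i + 1 = j →
      (i : WithBot ℕ∞) < ringKrullDim (R ⧸ (a₁ ⊔ a₂)) := by
    rintro _ hj i rfl
    rw [hdim] at hj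
    have hj' : i + 1 < d := by exact_mod_cast hj
    exact lt_of_lt_of_le (by exact_mod_cast (by omega : i < d - 1)) hdimb
  constructor
  · intro h₁ h₂ hb
    have := h₁.charP
    have := h₂.charP
    have := hb.charP
    refine ⟨inferInstance, inferInstance, fun n x hx j hj => ?_⟩
    exact cechCohomologyFrobenius_of_inf_eq_bot (P := fun M _ _ ρ => IsNilpotentAction ρ)
      (fun _ _ _ _ _ _ _ _ _ _ _ _ _ _ _ => IsNilpotentAction.of_exact) hx ha j
      (h₁.isNilpotentAction_quotient hx (hj.trans_eq (hdim.trans hdim₁.symm)))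
      (h₂.isNilpotentAction_quotient hx (hj.trans_eq (hdim.trans hdim₂.symm)))
      fun i hi => hb.isNilpotentAction_quotient hx (hlt hj i hi)
  · intro _ h₁ h₂ hb
    have := h₁.charP
    have := h₂.charP
    have := hb.charP
    refine ⟨inferInstance, inferInstance, fun n x hx j hj => ?_⟩
    exact cechCohomologyFrobenius_of_inf_eq_bot
      (P := fun M _ _ ρ => IsGeneralizedNilpotentAction ρ)
      (fun _ _ _ _ _ _ _ _ _ _ _ _ _ _ _ => IsGeneralizedNilpotentAction.of_exact) hx ha j
      (h₁.isGeneralizedNilpotentAction_quotient hx (hj.trans_eq (hdim.trans hdim₁.symm)))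
      (h₂.isGeneralizedNilpotentAction_quotient hx (hj.trans_eq (hdim.trans hdim₂.symm)))
      fun i hi => hb.isGeneralizedNilpotentAction_quotient hx (hlt hj i hi)
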